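/- Let $p\ge 1$, $t_0<T$, and let $\hat\Omega\subset\mathbb R^p$ be a bounded open reference domain that is subdivided into finitely many pairwise disjoint open blocks $\hat K_1,\dots,\hat K_N\subset\hat\Omega$ with boundaries of measure zero, $\hat\Omega\subset\bigcup_k\overline{\hat K_k}$. Let $x=x(\hat x,t)$, $t\in[t_0,T]$, $\hat x\in\overline{\hat\Omega}$, be a motion that is continuous on $\overline{\hat\Omega}\times[t_0,T]$, twice continuously differentiable on each $\overline{\hat K_k}\times[t_0,T]$, injective in $\hat x$ for every $t$ (with inverse $\hat x(x,t)$), and non-degenerate: its Jacobian determinant $J=\det(\partial x/\partial\hat x)$ is bounded below by a positive constant on all blocks and all times (at block boundaries $J$ denotes a one-sided limit from an adjacent block). Put $\Omega(t)=x(\hat\Omega,t)$, and assume that for every $t\in[t_0,T]$ the boundary of the bounded open set $\Omega(t)$ is piecewise smooth: $\partial\Omega(t)$ has finite surface measure and, off a set of zero surface measure, is locally a $C^1$ hypersurface with $\Omega(t)$ on one side. Let $n$ be the outward unit normal, let $\dot x(x,t)=\partial_t x(\hat x,t)|_{\hat x=\hat x(x,t)}$ be the coordinate velocity, and write $(\phi,\psi)_\Omega=\int_\Omega\phi\psi\,dV$,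 $\|\phi\|_\Omega^2=(\phi,\phi)_\Omega$, $(\phi,\psi)_{\partial\Omega}=\oint_{\partial\Omega}\phi\psi\,dS$, and $$D_m\phi=\tfrac12\big[\dot x^T(\nabla\phi)+\nabla\cdot(\dot x\,\phi)\big].$$ Let $D$ be a (possibly nonlinear, partially defined) operator taking real functions on $\bar Q=\{(x,t):t_0\le t\le T,\ x\in\overline{\Omega(t)}\}$ to such functions, and let $B$ be a (possibly nonlinear, partially defined) boundary operator taking functions on $\bar Q$ to functions on $\{(x,t):t_0<t<T,\ x\in\partial\Omega(t)\}$. Let $\mathcal U$ be the set of all continuous $\phi:\bar Q\to\mathbb R$ for which $\phi_t$ and $\nabla\phi$ exist for $x\in\Omega(t)$ and extend continuously to $\bar Q$, and for which $D\phi$ exists and is continuous on $\bar Q$. For $\phi$ on $\bar Q$ let $$\hat\phi(\hat x,t)=\sqrt{J}\,\phi(x(\hat x,t),t),\qquad \hat x\in\overline{\hat\Omega},\ t_0\le t\le T,$$ let $\hat{\mathcal U}=\{\hat\phi:\phi\in\mathcal U\}$, and let $\hat D=\sqrt J\,(D+D_m)\sqrt J^{-1}$ and $\hat B=B\sqrt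 J^{-1}$, expressed in the reference coordinates, i.e. $\hat D\hat\phi=\sqrt J\,(D\phi+D_m\phi)(x(\hat x,t),t)$ and $\hat B\hat\phi=(B\phi)(x(\hat x,t),t)$. Then for every $\alpha\in\mathbb R$ the following two statements are equivalent. 1. For all $\phi\in\mathcal U$ satisfying $B\phi=0$ and all $t\in(t_0,T)$, $$\big(\phi,D\phi\big)_{\Omega(t)}+\tfrac12\big(\phi,(n^T\dot x)\phi\big)_{\partial\Omega(t)}\le\alpha\|\phi\|^2_{\Omega(t)}.$$ 2. For all $\hat\phi\in\hat{\mathcal U}$ satisfying $\hat B\hat\phi=0$ and all $t\in(t_0,T)$, $$\big(\hat\phi,\hat D\hat\phi\big)_{\hat\Omega}\le\alpha\|\hat\phi\|^2_{\hat\Omega}.$$ -/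

import Mathlib

open Set MeasureTheory Topology

noncomputable section

namespace MovingMesh

/-- Physical (or reference) space `ℝᵖ` with its Euclidean structure. -/
abbrev Space (p : ℕ) : Type := EuclideanSpace ℝ (Fin p)

/-! ### Domains with piecewise smooth boundary -/

/-- `ν` is the outward unit normal to the open set `Ω` at the boundary point `x`, and `∂Ω` is a
`C¹` hypersurface near `x` with `Ω` lying on one side of it: near `x` the set `Ω` is `{ρ < 0}` for
a `C¹` function `ρ` with `ρ x = 0` and nonvanishing gradient, and `ν = ∇ρ / |∇ρ|` at `x`. -/
def IsOutwardNormal {p : ℕ} (Ω : Set (Space p)) (x ν : Space p) : Prop :=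
  ∃ (U : Set (Space p)) (ρ : Space p → ℝ), IsOpen U ∧ x ∈ U ∧ ContDiffOn ℝ 1 ρ U ∧
    (∀ y ∈ U, gradient ρ y ≠ 0) ∧ Ω ∩ U = {y ∈ U | ρ y < 0} ∧ ρ x = 0 ∧
    ν = ‖gradient ρ x‖⁻¹ • gradient ρ x

open Classical in
/-- The outward unit normal `n` of `Ω` at the regular boundary points (and `0` elsewhere). -/
def outwardNormal {p : ℕ} (Ω : Set (Space p)) (x : Space p) : Space p :=
  if h : ∃ ν, IsOutwardNormal Ω x ν then h.choose else 0

/-- The boundary points near which the boundary is not a `C¹` hypersurface (edges, corners, ...). -/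
def singularBoundary {p : ℕ} (Ω : Set (Space p)) : Set (Space p) :=
  {x ∈ frontier Ω | ¬ ∃ ν, IsOutwardNormal Ω x ν}

/-- Bounded open sets with piecewise `C¹` boundary: the boundary has finite surface measure and is
a `C¹` hypersurface, with the domain on one side, off a set of zero surface measure. -/
structure IsPiecewiseC1Domain {p : ℕ} (Ω : Set (Space p)) : Prop where
  isOpen : IsOpen Ω
  isBounded : Bornology.IsBounded Ω
  area_lt_top : (μHE[p - 1] : Measure (Space p)) (frontier Ω) < ⊤
  singular_null : (μHE[p - 1] : Measure (Space p)) (singularBoundary Ω) = 0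

/-- The volume inner product `(f, g)_A = ∫_A f g dV`. -/
def volInner {p : ℕ} (A : Set (Space p)) (f g : Space p → ℝ) : ℝ :=
  ∫ x in A, f x * g x

/-- The surface inner product `(f, g)_{∂A} = ∮_{∂A} f g dS`, where `dS` is the
`(p-1)`-dimensional Hausdorff measure, normalized to be the usual surface measure. -/
def surfInner {p : ℕ} (A : Set (Space p)) (f g : Space p → ℝ) : ℝ :=
  ∫ x in frontier A, f x * g x ∂(μHE[p - 1] : Measure (Space p))

/-- The divergence `∇ · V = ∑ᵢ ∂Vᵢ/∂xᵢ`. -/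
def divergence {p : ℕ} (V : Space p → Space p) (x : Space p) : ℝ :=
  ∑ i : Fin p, (fderiv ℝ V x (EuclideanSpace.single i 1)) i

open Classical in
/-- A function on a part `S` of space-time, as a function of `t` and `x` (zero off `S`). -/
def toFun₂ {p : ℕ} {S : Set (ℝ × Space p)} (f : S → ℝ) (t : ℝ) (x : Space p) : ℝ :=
  if h : (t, x) ∈ S then f ⟨(t, x), h⟩ else 0

/-! ### Moving domains -/

/-- A domain `Ω(t) = x(Ω̂, t)`, `t₀ ≤ t ≤ T`, moved by a non-degenerate, piecewise smooth motion
`x = X(t, x̂)` of a fixed bounded reference domain `Ω̂`, which is subdivided into finitely many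
non-overlapping blocks. -/
structure MovingDomain (p : ℕ) where
  /-- the initial time -/
  t₀ : ℝ
  /-- the final time -/
  T : ℝ
  t₀_lt_T : t₀ < T
  /-- the reference domain -/
  Ωhat : Set (Space p)
  isOpen_Ωhat : IsOpen Ωhat
  isBounded_Ωhat : Bornology.IsBounded Ωhat
  /-- the number of blocks -/
  N : ℕ
  /-- the (open) blocks of the reference domain -/
  block : Fin N → Set (Space p)
  isOpen_block : ∀ k, IsOpen (block k)
  block_subset : ∀ k, block k ⊆ Ωhat
  disjoint_block : Pairwise fun k l => Disjoint (block k) (block l)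
  subset_closure_block : Ωhat ⊆ ⋃ k, closure (block k)
  volume_frontier_block : ∀ k, volume (frontier (block k)) = 0
  /-- the coordinate mapping, time first -/
  X : ℝ → Space p → Space p
  /-- the mapping is globally continuous -/
  continuousOn_X : ContinuousOn (Function.uncurry X) (Icc t₀ T ×ˢ closure Ωhat)
  /-- the mapping is twice continuously differentiable on the closure of each block -/
  contDiffOn_X : ∀ k, ContDiffOn ℝ 2 (Function.uncurry X) (Icc t₀ T ×ˢ closure (block k))
  /-- the mapping is one-to-one at each time -/
  injOn_X : ∀ t ∈ Icc t₀ T, InjOn (X t) (closure Ωhat)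
  /-- the Jacobian determinant is positive, up to the closure of each block -/
  det_pos : ∃ c > 0, ∀ t ∈ Icc t₀ T, ∀ k, ∀ y ∈ block k, c ≤ (fderiv ℝ (X t) y).det
  /-- the physical domain has a piecewise smooth boundary -/
  piecewiseC1 : ∀ t ∈ Icc t₀ T, IsPiecewiseC1Domain (X t '' Ωhat)

namespace MovingDomain

variable {p : ℕ} (M : MovingDomain p)

/-- The physical domain `Ω(t)`. -/
def Ω (t : ℝ) : Set (Space p) := M.X t '' M.Ωhat

/-- The closure of the space-time domain: `t₀ ≤ t ≤ T` and `x` in the closure of `Ω(t)`. -/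
def physCyl : Set (ℝ × Space p) := {q | q.1 ∈ Icc M.t₀ M.T ∧ q.2 ∈ closure (M.Ω q.1)}

/-- `[t₀, T]` times the closure of `Ω̂`. -/
def refCyl : Set (ℝ × Space p) := {q | q.1 ∈ Icc M.t₀ M.T ∧ q.2 ∈ closure M.Ωhat}

/-- The moving boundary: `t₀ < t < T` and `x ∈ ∂Ω(t)`. -/
def physLat : Set (ℝ × Space p) := {q | q.1 ∈ Ioo M.t₀ M.T ∧ q.2 ∈ frontier (M.Ω q.1)}

/-- `(t₀, T) × ∂Ω̂`. -/
def refLat : Set (ℝ × Space p) := {q | q.1 ∈ Ioo M.t₀ M.T ∧ q.2 ∈ frontier M.Ωhat}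

theorem continuousOn_X_slice {t : ℝ} (ht : t ∈ Icc M.t₀ M.T) :
    ContinuousOn (M.X t) (closure M.Ωhat) :=
  M.continuousOn_X.comp (f := fun y => (t, y)) (by fun_prop) fun _ hy => ⟨ht, hy⟩

theorem image_closure {t : ℝ} (ht : t ∈ Icc M.t₀ M.T) :
    M.X t '' closure M.Ωhat = closure (M.Ω t) := by
  apply Subset.antisymm (M.continuousOn_X_slice ht).image_closure
  apply closure_minimal (image_mono subset_closure)
  exact (M.isBounded_Ωhat.isCompact_closure.image_of_continuousOn
    (M.continuousOn_X_slice ht)).isClosed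

theorem X_mem_frontier {t : ℝ} (ht : t ∈ Icc M.t₀ M.T) {y : Space p}
    (hy : y ∈ frontier M.Ωhat) : M.X t y ∈ frontier (M.Ω t) := by
  have hcl : y ∈ closure M.Ωhat := frontier_subset_closure hy
  rw [M.isOpen_Ωhat.frontier_eq] at hy
  have hop : IsOpen (M.Ω t) := (M.piecewiseC1 t ht).isOpen
  rw [hop.frontier_eq]
  refine ⟨M.image_closure ht ▸ mem_image_of_mem _ hcl, ?_⟩
  rintro ⟨z, hz, hzy⟩
  exact hy.2 (M.injOn_X t ht (subset_closure hz) hcl hzy ▸ hz)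

/-- The inverse coordinate mapping `x̂ = x̂(x, t)`. -/
def invX (t : ℝ) (x : Space p) : Space p := Function.invFunOn (M.X t) (closure M.Ωhat) x

/-- `(t, x̂) ↦ (t, x(x̂, t))`. -/
def toPhys (q : M.refCyl) : M.physCyl :=
  ⟨(q.1.1, M.X q.1.1 q.1.2), q.2.1, (M.image_closure q.2.1).subset (mem_image_of_mem _ q.2.2)⟩

/-- `(t, x) ↦ (t, x̂(x, t))`. -/
def toRef (q : M.physCyl) : M.refCyl :=
  ⟨(q.1.1, M.invX q.1.1 q.1.2), q.2.1,
    Function.invFunOn_mem ((M.image_closure q.2.1).symm.subset q.2.2)⟩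

/-- `(t, x̂) ↦ (t, x(x̂, t))` on the boundary. -/
def toPhysLat (q : M.refLat) : M.physLat :=
  ⟨(q.1.1, M.X q.1.1 q.1.2), q.2.1, M.X_mem_frontier (Ioo_subset_Icc_self q.2.1) q.2.2⟩

/-- The coordinate velocity `ẋ(x, t) = ∂ₜ X (t, x̂)` at `x̂ = x̂(x, t)`. -/
def velocity (t : ℝ) (x : Space p) : Space p :=
  derivWithin (fun s => M.X s (M.invX t x)) (Icc M.t₀ M.T) t

open Classical in
/-- The Jacobian determinant `J = det (∂x/∂x̂)` as a function of `t` and `x̂`. At the boundary of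
a block it is the limit from inside that block; at interfaces, where the limits from the blocks
that meet there may differ, one of them is selected. -/
def jac (t : ℝ) (y : Space p) : ℝ :=
  if h : ∃ k, y ∈ closure (M.block k) then
    extendFrom (M.block h.choose) (fun z => (fderiv ℝ (M.X t) z).det) y
  else 1

/-- The variable substitution `φ ↦ φ̂`, `φ̂(x̂, t) = √J φ(x(x̂, t), t)`. -/
def hat (φ : M.physCyl → ℝ) : M.refCyl → ℝ :=
  fun q => √(M.jac q.1.1 q.1.2) * φ (M.toPhys q)

/-- The inverse substitution `φ̂ ↦ √J⁻¹ φ̂`, as a function of the physical coordinates. -/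
def unhat (ψ : M.refCyl → ℝ) : M.physCyl → ℝ :=
  fun q => (√(M.jac (M.toRef q).1.1 (M.toRef q).1.2))⁻¹ * ψ (M.toRef q)

/-- `D_m φ = ½ [ẋᵀ (∇φ) + ∇ · (ẋ φ)]`. -/
def Dm (φ : M.physCyl → ℝ) : M.physCyl → ℝ := fun q =>
  (1 / 2) * (inner ℝ (M.velocity q.1.1 q.1.2) (gradient (toFun₂ φ q.1.1) q.1.2) +
    divergence (fun y => toFun₂ φ q.1.1 y • M.velocity q.1.1 y) q.1.2)

/-- A spatial operator, in general nonlinear and depending on `x` and `t`. It is a partial map,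
since `D φ` need not exist for every function `φ`. -/
abbrev Operator : Type := (M.physCyl → ℝ) →. (M.physCyl → ℝ)

/-- A boundary operator, mapping functions to functions on the moving boundary. -/
abbrev BoundaryOperator : Type := (M.physCyl → ℝ) →. (M.physLat → ℝ)

/-- The space `𝒰` of all `φ` such that `φ`, `φ_t`, `∇φ` and `D φ` exist and are continuous on the
closure of the space-time domain. -/
def admissible (D : M.Operator) : Set (M.physCyl → ℝ) :=
  {φ | Continuous φ ∧
    (∃ φt : M.physCyl → ℝ, Continuous φt ∧ ∀ q : M.physCyl, q.1.2 ∈ M.Ω q.1.1 →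
      HasDerivWithinAt (fun s => toFun₂ φ s q.1.2) (φt q) (Icc M.t₀ M.T) q.1.1) ∧
    (∃ G : M.physCyl → Space p, Continuous G ∧ ∀ q : M.physCyl, q.1.2 ∈ M.Ω q.1.1 →
      HasGradientAt (toFun₂ φ q.1.1) (G q) q.1.2) ∧
    ∃ g ∈ D φ, Continuous g}

/-- The space of all `φ̂ = √J φ` with `φ ∈ 𝒰`. -/
def admissibleHat (D : M.Operator) : Set (M.refCyl → ℝ) := M.hat '' M.admissible D

/-- `D̂ = √J (D + D_m) √J⁻¹`. -/
def Dhat (D : M.Operator) : (M.refCyl → ℝ) →. (M.refCyl → ℝ) :=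
  fun ψ => (D (M.unhat ψ)).map fun g => M.hat (g + M.Dm (M.unhat ψ))

/-- `B̂ = B √J⁻¹`, as a function of the reference coordinates. -/
def Bhat (B : M.BoundaryOperator) : (M.refCyl → ℝ) →. (M.refLat → ℝ) :=
  fun ψ => (B (M.unhat ψ)).map fun g => g ∘ M.toPhysLat

end MovingDomain

end MovingMesh

end

/-!
The substitution `φ ↦ φ̂ = √J φ(x(x̂, t), t)` is an isometry between `L²(Ω(t))` and `L²(Ω̂)`
(`volInner_hat`): this is the change of variables `x = x(x̂, t)`, carried out on the union of the
open blocks, which together with its image has full measure. Since `φ̂` determines `φ`, the second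
statement of the theorem says `(φ, Dφ + D_m φ) ≤ α ‖φ‖²` on `Ω(t)`, for the same functions `φ` as
in the first, and it remains to see that `(φ, D_m φ)` is the boundary term. By the product rule
`φ D_m φ = ½ ∇ · (φ² ẋ)`, so that this is the divergence theorem for `φ² ẋ` on `Ω(t)`
(`volInner_add_Dm`).

The field `φ² ẋ` need not be `C¹`, since `ẋ` has kinks at the interfaces between blocks. It is
continuous on the closure of `Ω(t)`, differentiable at almost every point, and at every point
`x` of `Ω(t)` it satisfies `|V(y) - V(x)| ≤ C |y - x|` for `y` near `x`, with one constant `C` for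
all `x`. On the closed reference blocks this is so because the velocity is differentiable and the
position has an invertible differential there; compactness makes the constant uniform.

The divergence theorem for such fields (`integral_divergence_eq`) is reduced to fields `f v` with
a constant vector `v`. Near a regular boundary point, where the normal is `ν`, the boundary lies
arbitrarily close to a hyperplane. If `⟨ν, u⟩ = 1`, integrating `∂f/∂u` along the lines parallel to
`u` gives the values of `f` on the boundary, integrated over the projection of the boundary to
the hyperplane along `u`. That projection changes distances, hence Hausdorff measure, only by a
factor close to `1`, so that the error is at most `δ ∫ |f|` (`abs_integral_lineDeriv_sub_le`). As
every `v` is a combination of two such vectors `u`, the two sides of the divergence theorem differ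
by at most `η ∫ |f|` for `f` supported near the point (`exists_nhds_abs_divergenceDefect_le`).
A bound of this form survives a partition of `f` into nonnegative multiples of itself, however
many pieces there are, so that it holds for every `f` vanishing near the singular part of the
boundary, for every `η > 0`
(`divergenceDefect_eq_zero_of_disjoint_singularBoundary`). Finally the singular part, a null set for
the surface measure, is cut off by functions whose gradients are small in `L¹`
(`exists_cutoff`, `divergenceDefect_eq_zero`).
-/

namespace MovingMesh
open Filter Module

/-! ### Functions with bounded pointwise Lipschitz constant -/

/-- The functions to which the divergence theorem is applied: `f` is continuous and, in the open
set `Ω`, has a uniformly bounded pointwise Lipschitz constant and is almost everywhere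
differentiable. -/
structure PointwiseLipschitzIn {p : ℕ} (Ω : Set (Space p)) (f : Space p → ℝ) : Prop where
  continuous : Continuous f
  exists_bound : ∃ C, ∀ x ∈ Ω, ∀ᶠ y in 𝓝 x, |f y - f x| ≤ C * ‖y - x‖
  ae_differentiableAt : ∀ᵐ x ∂volume, x ∈ Ω → DifferentiableAt ℝ f x

/-- The mean value inequality: no derivative is needed, since the pointwise bound controls the
upper right Dini derivative of `z ↦ |h z - h a|`. -/
theorem abs_sub_le_of_pointwise_lipschitz {h : ℝ → ℝ} {a b C : ℝ} (hab : a ≤ b)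
    (hc : ContinuousOn h (Icc a b))
    (hl : ∀ z ∈ Ico a b, ∀ᶠ w in 𝓝 z, |h w - h z| ≤ C * |w - z|) :
    |h b - h a| ≤ C * (b - a) := by
  let g : ℝ → ℝ := fun z => |h z - h a|
  have hg : ContinuousOn g (Icc a b) := by fun_prop
  have key := image_le_of_liminf_slope_right_le_deriv_boundary (f := g) (a := a) (b := b)
    hg (B := fun z => C * (z - a)) (B' := fun _ => C) (by simp [g]) (by fun_prop)
    (fun x _ => by simpa using (((hasDerivAt_id x).sub_const a).const_mul C).hasDerivWithinAt)
    ?_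
  · exact key ⟨hab, le_rfl⟩
  intro x hx r hr
  apply Eventually.frequently
  filter_upwards [(hl x hx).filter_mono nhdsWithin_le_nhds, self_mem_nhdsWithin] with z hz hxz
  have hpos : 0 < z - x := sub_pos.2 hxz
  rw [slope_def_field]
  refine lt_of_le_of_lt ?_ hr
  rw [div_le_iff₀ hpos]
  have h1 : |h z - h a| - |h x - h a| ≤ |h z - h x| := by
    have := abs_sub_abs_le_abs_sub (h z - h a) (h x - h a)
    simpa using this
  rw [abs_of_pos hpos] at hz
  exact h1.trans hz

/-- The fundamental theorem of calculus for a continuous function whose pointwise Lipschitz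
constant is bounded in the interior of the interval. -/
theorem integral_deriv_eq_sub_of_pointwise_lipschitz {h : ℝ → ℝ} {a b C : ℝ} (hab : a ≤ b)
    (hc : ContinuousOn h (Icc a b))
    (hl : ∀ z ∈ Ioo a b, ∀ᶠ w in 𝓝 z, |h w - h z| ≤ C * |w - z|) :
    ∫ z in a..b, deriv h z = h b - h a := by
  have hlip : ∀ x ∈ Ioo a b, ∀ y ∈ Icc a b, x ≤ y → |h y - h x| ≤ C * (y - x) := by
    intro x hx y hy hxy
    exact abs_sub_le_of_pointwise_lipschitz hxy (hc.mono (Icc_subset_Icc hx.1.le hy.2))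
      fun z hz => hl z ⟨hx.1.trans_le hz.1, hz.2.trans_le hy.2⟩
  have hlip' : ∀ x ∈ Icc a b, ∀ y ∈ Icc a b, x ≤ y → |h y - h x| ≤ C * (y - x) := by
    intro x hx y hy hxy
    rcases hxy.eq_or_lt with rfl | hlt
    · simp
    -- the left endpoint is reached as a limit from the right
    have hm : Ioo x y ∈ 𝓝[>] x := Ioo_mem_nhdsGT hlt
    have hcx : Tendsto h (𝓝[>] x) (𝓝 (h x)) := by
      refine ((hc x hx).mono (t := Icc a b) subset_rfl).tendsto.mono_left ?_
      refine le_inf (nhdsWithin_le_nhds) (le_principal_iff.2 ?_)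
      filter_upwards [hm] with z hz using ⟨hx.1.trans hz.1.le, hz.2.le.trans hy.2⟩
    refine le_of_tendsto_of_tendsto (b := 𝓝[>] x) (f := fun z => |h y - h z|)
      (g := fun z => C * (y - z)) (tendsto_const_nhds.sub hcx).abs ?_ ?_
    · exact ((continuous_const.mul (continuous_const.sub continuous_id)).tendsto x).mono_left
        nhdsWithin_le_nhds
    · filter_upwards [hm] with z hz
      exact hlip z ⟨hx.1.trans_lt hz.1, hz.2.trans_le hy.2⟩ y hy hz.2.le
  have hL : LipschitzOnWith C.toNNReal h (uIcc a b) := by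
    rw [uIcc_of_le hab]
    apply LipschitzOnWith.of_dist_le_mul
    intro x hx y hy
    have hC : ∀ r : ℝ, 0 ≤ r → C * r ≤ C.toNNReal * r := fun r hr =>
      mul_le_mul_of_nonneg_right (Real.le_coe_toNNReal C) hr
    rcases le_total x y with hxy | hxy
    · rw [dist_comm, Real.dist_eq, dist_comm, Real.dist_eq, abs_of_nonneg (sub_nonneg.2 hxy)]
      exact (hlip' x hx y hy hxy).trans (hC _ (sub_nonneg.2 hxy))
    · rw [Real.dist_eq, Real.dist_eq, abs_of_nonneg (sub_nonneg.2 hxy)]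
      exact (hlip' y hy x hx hxy).trans (hC _ (sub_nonneg.2 hxy))
  exact hL.absolutelyContinuousOnInterval.integral_deriv_eq_sub

section LineDeriv

variable {p : ℕ} {Ω : Set (Space p)} {f : Space p → ℝ}

theorem abs_lineDeriv_le {C : ℝ} (hC : 0 ≤ C) {x : Space p}
    (h : ∀ᶠ y in 𝓝 x, |f y - f x| ≤ C * ‖y - x‖) (v : Space p) :
    |lineDeriv ℝ f x v| ≤ C * ‖v‖ := by
  have := norm_lineDeriv_le_of_lip' (𝕜 := ℝ) (f := f) (x₀ := x) (v := v) hC h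
  simpa using this

theorem PointwiseLipschitzIn.exists_bound_nonneg (hf : PointwiseLipschitzIn Ω f) :
    ∃ C, 0 ≤ C ∧ ∀ x ∈ Ω, ∀ᶠ y in 𝓝 x, |f y - f x| ≤ C * ‖y - x‖ := by
  obtain ⟨C, hC⟩ := hf.exists_bound
  refine ⟨max C 0, le_max_right _ _, fun x hx => ?_⟩
  filter_upwards [hC x hx] with y hy
  exact hy.trans (mul_le_mul_of_nonneg_right (le_max_left _ _) (norm_nonneg _))

theorem PointwiseLipschitzIn.integrableOn_lineDeriv (hf : PointwiseLipschitzIn Ω f)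
    (hΩ : IsOpen Ω) (hb : Bornology.IsBounded Ω) (v : Space p) :
    IntegrableOn (fun x => lineDeriv ℝ f x v) Ω := by
  obtain ⟨C, hC0, hC⟩ := hf.exists_bound_nonneg
  refine Measure.integrableOn_of_bounded (M := C * ‖v‖) hb.measure_lt_top.ne
    (measurable_lineDeriv hf.continuous).aestronglyMeasurable ?_
  filter_upwards [ae_restrict_mem hΩ.measurableSet] with x hx
  exact abs_lineDeriv_le hC0 (hC x hx) v

/-- The class is stable under multiplication by Lipschitz functions. -/
theorem PointwiseLipschitzIn.lipschitz_mul (hf : PointwiseLipschitzIn Ω f)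
    (hb : Bornology.IsBounded Ω) {χ : Space p → ℝ} {K : NNReal} (hχ : LipschitzWith K χ) :
    PointwiseLipschitzIn Ω (fun x => χ x * f x) := by
  obtain ⟨C, hC0, hC⟩ := hf.exists_bound_nonneg
  have hcpt := hb.isCompact_closure
  obtain ⟨A, hA⟩ := hcpt.exists_bound_of_continuousOn hf.continuous.continuousOn
  obtain ⟨A', hA'⟩ := hcpt.exists_bound_of_continuousOn hχ.continuous.continuousOn
  refine ⟨hχ.continuous.mul hf.continuous, ⟨(A' + 1) * C + K * A, fun x hx => ?_⟩, ?_⟩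
  · have hxA := hA x (subset_closure hx)
    have hxA' := hA' x (subset_closure hx)
    have hnear : ∀ᶠ y in 𝓝 x, |χ y| < A' + 1 :=
      (hχ.continuous.abs.tendsto x).eventually_lt_const (by rw [Real.norm_eq_abs] at hxA'; linarith)
    filter_upwards [hC x hx, hnear] with y hy hy'
    have h1 : χ y * f y - χ x * f x = χ y * (f y - f x) + (χ y - χ x) * f x := by ring
    have h2 : |χ y - χ x| ≤ K * ‖y - x‖ := by
      simpa [dist_eq_norm] using hχ.dist_le_mul y x
    rw [h1]
    refine (abs_add_le _ _).trans ?_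
    rw [abs_mul, abs_mul]
    have h3 : |χ y| * |f y - f x| ≤ (A' + 1) * (C * ‖y - x‖) :=
      mul_le_mul hy'.le hy (abs_nonneg _) ((abs_nonneg _).trans hy'.le)
    have h4 : |χ y - χ x| * |f x| ≤ (K * ‖y - x‖) * A :=
      mul_le_mul h2 hxA (abs_nonneg _) (by positivity)
    linarith
  · filter_upwards [hf.ae_differentiableAt, hχ.ae_differentiableAt] with x h1 h2 hx
    exact h2.mul (h1 hx)

end LineDeriv

/-! ### Skew coordinates -/

section Coordinates

variable {p : ℕ}

/-- Skew coordinates `(z, y) ↦ y + z u`, with `y` in the hyperplane orthogonal to the unit vector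
`ν` and `⟨ν, u⟩ = 1`, preserve the volume. -/
theorem measurePreserving_skewCoord {ν u : Space p} (hν : ‖ν‖ = 1) (hu : inner ℝ ν u = 1) :
    MeasurePreserving (fun q : ℝ × (ℝ ∙ ν)ᗮ => (q.2 : Space p) + q.1 • u)
      (volume.prod volume) volume := by
  have h1 : MeasurePreserving (((ℝ ∙ ν).measurableEquivProd (0 : Space p)).symm)
      volume volume := by
    have := ((ℝ ∙ ν).measurePreserving_measurableEquivProd (0 : Space p)).symm
    rwa [InnerProductSpace.euclideanHausdorffMeasure_eq_volume] at this
  have h2 : MeasurePreserving (fun z : ℝ => (LinearIsometryEquiv.toSpanUnitSingleton ν hν) z)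
      volume volume :=
    (LinearIsometryEquiv.toSpanUnitSingleton ν hν).measurePreserving
  have hmem : u - ν ∈ (ℝ ∙ ν)ᗮ := by
    rw [Submodule.mem_orthogonal_singleton_iff_inner_right, inner_sub_right, hu,
      real_inner_self_eq_norm_sq, hν]
    norm_num
  let w : (ℝ ∙ ν)ᗮ := ⟨u - ν, hmem⟩
  have h3 : MeasurePreserving (fun q : ℝ × (ℝ ∙ ν)ᗮ =>
      ((LinearIsometryEquiv.toSpanUnitSingleton ν hν) q.1, q.2 + q.1 • w))
      (volume.prod volume) (volume.prod volume) :=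
    h2.skew_product (g := fun z y => y + z • w) (by fun_prop)
      (ae_of_all _ fun z => (measurePreserving_add_right volume (z • w)).map_eq)
  have h4 := h1.comp h3
  convert h4 using 1
  ext1 q
  simp only [Function.comp, Submodule.measurableEquivProd_symm_apply, w,
    LinearIsometryEquiv.toSpanUnitSingleton_apply]
  simp only [Submodule.coe_add, Submodule.coe_smul, smul_sub, vadd_eq_add, add_zero]
  abel

theorem integral_eq_integral_skewCoord {ν u : Space p} (hν : ‖ν‖ = 1) (hu : inner ℝ ν u = 1)
    {G : Space p → ℝ} (hG : Integrable G) :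
    ∫ x, G x = ∫ y : (ℝ ∙ ν)ᗮ, ∫ z : ℝ, G ((y : Space p) + z • u) := by
  have hmp := measurePreserving_skewCoord hν hu
  have hint := hmp.integrable_comp_of_integrable hG
  have h1 : ∫ x, G x = ∫ q : ℝ × (ℝ ∙ ν)ᗮ, G ((q.2 : Space p) + q.1 • u)
      ∂(volume.prod volume) := by
    have := integral_map (μ := volume.prod volume) (f := G) hmp.measurable.aemeasurable
      (by rw [hmp.map_eq]; exact hG.aestronglyMeasurable)
    rwa [hmp.map_eq] at this
  rw [h1]
  exact integral_prod_symm _ hint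

end Coordinates

/-! ### The outward normal -/

section Normal

variable {p : ℕ} {Ω : Set (Space p)}

theorem IsOutwardNormal.norm_eq_one {x ν : Space p} (h : IsOutwardNormal Ω x ν) : ‖ν‖ = 1 := by
  obtain ⟨U, ρ, -, hxU, -, hg, -, -, rfl⟩ := h
  rw [norm_smul, norm_inv, norm_norm, inv_mul_cancel₀ (norm_ne_zero_iff.2 (hg x hxU))]

theorem eventually_lt_of_inner_gradient_neg {ρ : Space p → ℝ} {x w : Space p}
    (hd : DifferentiableAt ℝ ρ x) (h0 : ρ x = 0) (hw : inner ℝ (gradient ρ x) w < 0) :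
    ∀ᶠ s in 𝓝[>] (0 : ℝ), ρ (x + s • w) < 0 := by
  have h1 := (hd.hasGradientAt.hasFDerivAt.hasLineDerivAt w).tendsto_slope_zero_right
  simp only [InnerProductSpace.toDual_apply_apply] at h1
  filter_upwards [h1.eventually_lt_const hw, self_mem_nhdsWithin] with s hs hs0
  rw [h0, sub_zero, smul_eq_mul] at hs
  by_contra hcon
  exact absurd hs (not_lt.2 (mul_nonneg (inv_nonneg.2 (le_of_lt hs0)) (not_lt.1 hcon)))

theorem eventually_gt_of_inner_gradient_pos {ρ : Space p → ℝ} {x w : Space p}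
    (hd : DifferentiableAt ℝ ρ x) (h0 : ρ x = 0) (hw : 0 < inner ℝ (gradient ρ x) w) :
    ∀ᶠ s in 𝓝[>] (0 : ℝ), 0 < ρ (x + s • w) := by
  have h1 := (hd.hasGradientAt.hasFDerivAt.hasLineDerivAt w).tendsto_slope_zero_right
  simp only [InnerProductSpace.toDual_apply_apply] at h1
  filter_upwards [h1.eventually_const_lt hw, self_mem_nhdsWithin] with s hs hs0
  rw [h0, sub_zero, smul_eq_mul] at hs
  by_contra hcon
  exact absurd hs (not_lt.2 (mul_nonpos_of_nonneg_of_nonpos (inv_nonneg.2 (le_of_lt hs0))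
    (not_lt.1 hcon)))

theorem tendsto_add_smul_nhdsGT (x w : Space p) :
    Tendsto (fun s : ℝ => x + s • w) (𝓝[>] 0) (𝓝 x) := by
  have : Tendsto (fun s : ℝ => x + s • w) (𝓝 0) (𝓝 (x + (0 : ℝ) • w)) :=
    Continuous.tendsto (by fun_prop) 0
  rw [zero_smul, add_zero] at this
  exact this.mono_left nhdsWithin_le_nhds

/-- The outward unit normal is unique: two half-spaces that both approximate `Ω` at `x` agree. -/
theorem IsOutwardNormal.unique {x ν ν' : Space p} (h : IsOutwardNormal Ω x ν)
    (h' : IsOutwardNormal Ω x ν') : ν = ν' := by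
  have hn := h.norm_eq_one
  have hn' := h'.norm_eq_one
  obtain ⟨U, ρ, hU, hxU, hρ, hg, hΩ, h0, hν⟩ := h
  obtain ⟨U', ρ', hU', hxU', hρ', hg', hΩ', h0', hν'⟩ := h'
  by_contra hne
  have hlt : inner ℝ ν ν' < 1 := (inner_lt_one_iff_real_of_norm_eq_one hn hn').2 hne
  have hd : DifferentiableAt ℝ ρ x :=
    (hρ.contDiffAt (hU.mem_nhds hxU)).differentiableAt (by norm_num)
  have hd' : DifferentiableAt ℝ ρ' x :=
    (hρ'.contDiffAt (hU'.mem_nhds hxU')).differentiableAt (by norm_num)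
  have hpos : 0 < ‖gradient ρ x‖ := norm_pos_iff.2 (hg x hxU)
  have hpos' : 0 < ‖gradient ρ' x‖ := norm_pos_iff.2 (hg' x hxU')
  have e1 : gradient ρ x = ‖gradient ρ x‖ • ν := by
    rw [hν, smul_smul, mul_inv_cancel₀ hpos.ne', one_smul]
  have e2 : gradient ρ' x = ‖gradient ρ' x‖ • ν' := by
    rw [hν', smul_smul, mul_inv_cancel₀ hpos'.ne', one_smul]
  -- the direction `ν' - ν` points into `Ω` according to `ρ` and out of it according to `ρ'`
  have i1 : inner ℝ (gradient ρ x) (ν' - ν) < 0 := by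
    rw [e1, real_inner_smul_left, inner_sub_right, real_inner_self_eq_norm_sq, hn]
    nlinarith
  have i2 : 0 < inner ℝ (gradient ρ' x) (ν' - ν) := by
    rw [e2, real_inner_smul_left, inner_sub_right, real_inner_self_eq_norm_sq, hn',
      real_inner_comm]
    exact mul_pos hpos' (by linarith)
  have ht := tendsto_add_smul_nhdsGT x (ν' - ν)
  obtain ⟨s, h1, h2, h3, h4⟩ := ((eventually_lt_of_inner_gradient_neg hd h0 i1).and
    ((eventually_gt_of_inner_gradient_pos hd' h0' i2).and
    ((ht.eventually_mem (hU.mem_nhds hxU)).and (ht.eventually_mem (hU'.mem_nhds hxU'))))).exists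
  have m1 : x + s • (ν' - ν) ∈ Ω ∩ U := hΩ ▸ (⟨h3, h1⟩ : _ ∈ {y ∈ U | ρ y < 0})
  have m2 : x + s • (ν' - ν) ∈ {y ∈ U' | ρ' y < 0} := hΩ' ▸ ⟨m1.1, h4⟩
  exact absurd m2.2 (not_lt.2 h2.le)

theorem IsOutwardNormal.outwardNormal_eq {x ν : Space p} (h : IsOutwardNormal Ω x ν) :
    outwardNormal Ω x = ν := by
  have hex : ∃ ν, IsOutwardNormal Ω x ν := ⟨ν, h⟩
  rw [outwardNormal, dif_pos hex]
  exact hex.choose_spec.unique h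

theorem norm_outwardNormal_le (Ω : Set (Space p)) (x : Space p) : ‖outwardNormal Ω x‖ ≤ 1 := by
  by_cases h : ∃ ν, IsOutwardNormal Ω x ν
  · obtain ⟨ν, hν⟩ := h
    rw [hν.outwardNormal_eq, hν.norm_eq_one]
  · rw [outwardNormal, dif_neg h]
    simp

/-- Where `Ω` is given by `ρ < 0`, its frontier is given by `ρ = 0`. -/
theorem mem_frontier_iff_of_defining {U : Set (Space p)} {ρ : Space p → ℝ} (hΩo : IsOpen Ω)
    (hU : IsOpen U) (hρ : ContDiffOn ℝ 1 ρ U) (hg : ∀ y ∈ U, gradient ρ y ≠ 0)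
    (hΩ : Ω ∩ U = {y ∈ U | ρ y < 0}) {y : Space p} (hy : y ∈ U) :
    y ∈ frontier Ω ↔ ρ y = 0 := by
  have hd : DifferentiableAt ℝ ρ y :=
    (hρ.contDiffAt (hU.mem_nhds hy)).differentiableAt (by norm_num)
  have hmem : ∀ z ∈ U, z ∈ Ω ↔ ρ z < 0 := fun z hz =>
    ⟨fun h => (hΩ.subset ⟨h, hz⟩).2, fun h => (hΩ.symm.subset ⟨hz, h⟩).1⟩
  rw [hΩo.frontier_eq]
  constructor
  · rintro ⟨hcl, hn⟩
    refine le_antisymm ?_ (not_lt.1 fun h => hn ((hmem y hy).2 h))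
    by_contra hpos
    have hev : ∀ᶠ z in 𝓝 y, 0 < ρ z ∧ z ∈ U :=
      (hd.continuousAt.eventually_const_lt (not_le.1 hpos)).and (hU.mem_nhds hy)
    obtain ⟨z, hz, hzΩ⟩ := mem_closure_iff_nhds.1 hcl _ hev
    exact absurd ((hmem z hz.2).1 hzΩ) (not_lt.2 hz.1.le)
  · intro h0
    refine ⟨?_, fun h => ((hmem y hy).1 h).ne h0⟩
    have hi : inner ℝ (gradient ρ y) (-gradient ρ y) < 0 := by
      rw [inner_neg_right, real_inner_self_eq_norm_sq]
      have := norm_pos_iff.2 (hg y hy)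
      nlinarith
    have ht := tendsto_add_smul_nhdsGT y (-gradient ρ y)
    refine mem_closure_of_tendsto ht ?_
    filter_upwards [eventually_lt_of_inner_gradient_neg hd h0 hi,
      ht.eventually_mem (hU.mem_nhds hy)] with s h1 h2
    exact (hmem _ h2).2 h1

theorem continuousOn_gradient {U : Set (Space p)} {ρ : Space p → ℝ} (hU : IsOpen U)
    (hρ : ContDiffOn ℝ 1 ρ U) : ContinuousOn (gradient ρ) U := by
  have := hρ.continuousOn_fderiv_of_isOpen hU le_rfl
  exact (InnerProductSpace.toDual ℝ (Space p)).symm.continuous.comp_continuousOn this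

/-- The regular part of the boundary is relatively open, and the normal is continuous on it. -/
theorem IsOutwardNormal.exists_nhds {x ν : Space p} (hΩo : IsOpen Ω)
    (h : IsOutwardNormal Ω x ν) : ∃ U, IsOpen U ∧ x ∈ U ∧
      (∀ y ∈ U ∩ frontier Ω, ∃ ν, IsOutwardNormal Ω y ν) ∧
      ContinuousOn (outwardNormal Ω) (U ∩ frontier Ω) := by
  obtain ⟨U, ρ, hU, hxU, hρ, hg, hΩ, h0, hν⟩ := h
  have key : ∀ y ∈ U ∩ frontier Ω, IsOutwardNormal Ω y (‖gradient ρ y‖⁻¹ • gradient ρ y) :=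
    fun y hy => ⟨U, ρ, hU, hy.1, hρ, hg, hΩ,
      (mem_frontier_iff_of_defining hΩo hU hρ hg hΩ hy.1).1 hy.2, rfl⟩
  refine ⟨U, hU, hxU, fun y hy => ⟨_, key y hy⟩, ?_⟩
  have hc : ContinuousOn (fun y => ‖gradient ρ y‖⁻¹ • gradient ρ y) (U ∩ frontier Ω) := by
    have hgc := (continuousOn_gradient hU hρ).mono (inter_subset_left (t := frontier Ω))
    exact (hgc.norm.inv₀ fun y hy => (norm_ne_zero_iff.2 (hg y hy.1))).smul hgc
  exact hc.congr fun y hy => (key y hy).outwardNormal_eq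

theorem IsPiecewiseC1Domain.isClosed_singularBoundary (h : IsPiecewiseC1Domain Ω) :
    IsClosed (singularBoundary Ω) := by
  rw [← isOpen_compl_iff, isOpen_iff_mem_nhds]
  intro x hx
  by_cases hxf : x ∈ frontier Ω
  · obtain ⟨ν, hν⟩ : ∃ ν, IsOutwardNormal Ω x ν := by
      by_contra hcon
      exact hx ⟨hxf, hcon⟩
    obtain ⟨U, hU, hxU, hreg, -⟩ := hν.exists_nhds h.isOpen
    filter_upwards [hU.mem_nhds hxU] with y hy hys
    exact hys.2 (hreg y ⟨hy, hys.1⟩)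
  · filter_upwards [isClosed_frontier.isOpen_compl.mem_nhds hxf] with y hy hys
    exact hy hys.1

theorem IsPiecewiseC1Domain.aestronglyMeasurable_outwardNormal (h : IsPiecewiseC1Domain Ω) :
    AEStronglyMeasurable (outwardNormal Ω)
      ((μHE[p - 1] : Measure (Space p)).restrict (frontier Ω)) := by
  have hc : ContinuousOn (outwardNormal Ω) (frontier Ω \ singularBoundary Ω) := by
    intro x hx
    obtain ⟨ν, hν⟩ : ∃ ν, IsOutwardNormal Ω x ν := by
      by_contra hcon
      exact hx.2 ⟨hx.1, hcon⟩
    obtain ⟨U, hU, hxU, hreg, hcU⟩ := hν.exists_nhds h.isOpen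
    have := hcU x ⟨hxU, hx.1⟩
    refine this.mono_of_mem_nhdsWithin ?_
    filter_upwards [nhdsWithin_le_nhds (hU.mem_nhds hxU), self_mem_nhdsWithin] with y hy hy'
    exact ⟨hy, hy'.1⟩
  have hmeas : MeasurableSet (frontier Ω \ singularBoundary Ω) :=
    isClosed_frontier.measurableSet.diff h.isClosed_singularBoundary.measurableSet
  have heq : ((μHE[p - 1] : Measure (Space p)).restrict (frontier Ω)) =
      (μHE[p - 1] : Measure (Space p)).restrict (frontier Ω \ singularBoundary Ω) :=
    Measure.restrict_congr_set (sdiff_null_ae_eq_self h.singular_null).symm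
  rw [heq]
  exact hc.aestronglyMeasurable hmeas

end Normal

/-! ### Integration along lines -/

section Lines

variable {p : ℕ} {Ω B : Set (Space p)} {f : Space p → ℝ}

theorem lineDeriv_eq_deriv_line (f : Space p → ℝ) (y u : Space p) (z : ℝ) :
    lineDeriv ℝ f (y + z • u) u = deriv (fun s : ℝ => f (y + s • u)) z := by
  have h := deriv_comp_const_add (fun s : ℝ => f (y + s • u)) z 0
  rw [add_zero] at h
  rw [← h, lineDeriv]
  congr 1
  ext t
  rw [add_smul, add_assoc]

theorem eventually_eq_zero_of_notMem_tsupport {x : Space p} (hx : x ∉ tsupport f) :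
    ∀ᶠ y in 𝓝 x, f y = 0 :=
  notMem_tsupport_iff_eventuallyEq.1 hx

theorem lineDeriv_eq_zero_of_notMem_tsupport {x : Space p} (hx : x ∉ tsupport f) (u : Space p) :
    lineDeriv ℝ f x u = 0 := by
  rw [(notMem_tsupport_iff_eventuallyEq.1 hx : f =ᶠ[𝓝 x] fun _ => 0).lineDeriv_eq]
  simp [lineDeriv]

/-- A line leaves a bounded set in both directions. -/
theorem exists_forall_le_abs_notMem (hB : Bornology.IsBounded B) {u : Space p} (hu : u ≠ 0)
    (y : Space p) : ∃ R : ℝ, ∀ z : ℝ, R ≤ |z| → y + z • u ∉ B := by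
  obtain ⟨r, hr⟩ := hB.exists_norm_le
  have hu' : 0 < ‖u‖ := norm_pos_iff.2 hu
  refine ⟨(r + ‖y‖) / ‖u‖ + 1, fun z hz hmem => ?_⟩
  have h1 := hr _ hmem
  have h2 : ‖z • u‖ ≤ r + ‖y‖ := by
    calc ‖z • u‖ = ‖(y + z • u) - y‖ := by simp
      _ ≤ ‖y + z • u‖ + ‖y‖ := norm_sub_le _ _
      _ ≤ _ := by linarith
  rw [norm_smul, Real.norm_eq_abs, ← le_div_iff₀ hu'] at h2
  linarith

/-- The fundamental theorem of calculus on a half-line that stays in `Ω` as long as it is in the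
set `B` containing the support of `f`. -/
theorem integral_deriv_line (hf : PointwiseLipschitzIn Ω f) (hfB : tsupport f ⊆ B)
    (y u : Space p) {a b : ℝ} (hab : a ≤ b)
    (hin : ∀ z < b, y + z • u ∈ B → y + z • u ∈ Ω) (ha : y + a • u ∉ B) :
    ∫ z in a..b, deriv (fun s : ℝ => f (y + s • u)) z = f (y + b • u) := by
  obtain ⟨C, hC0, hC⟩ := hf.exists_bound_nonneg
  have hline : Continuous fun s : ℝ => y + s • u := by fun_prop
  have h0 : f (y + a • u) = 0 := image_eq_zero_of_notMem_tsupport fun h => ha (hfB h)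
  rw [integral_deriv_eq_sub_of_pointwise_lipschitz (C := C * ‖u‖) hab
    (Continuous.continuousOn (by have := hf.continuous; fun_prop)), h0, sub_zero]
  intro z hz
  by_cases hzB : y + z • u ∈ tsupport f
  · have hev := (hline.tendsto z).eventually (hC _ (hin z hz.2 (hfB hzB)))
    filter_upwards [hev] with w hw
    refine hw.trans (le_of_eq ?_)
    rw [add_sub_add_left_eq_sub, ← sub_smul, norm_smul, Real.norm_eq_abs]
    ring
  · have hev := (hline.tendsto z).eventually (eventually_eq_zero_of_notMem_tsupport hzB)
    filter_upwards [hev] with w hw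
    rw [hw, hev.self_of_nhds, sub_zero, abs_zero]
    positivity

/-- On a line that crosses the boundary of `Ω` inside `B` once, from inside to outside, the
integral of the derivative over the part in `Ω` is the boundary value. -/
theorem integral_indicator_line_of_mem (hf : PointwiseLipschitzIn Ω f) (hfB : tsupport f ⊆ B)
    (hB : Bornology.IsBounded B) {y u : Space p} (hu : u ≠ 0) {b : ℝ}
    (hin : ∀ z, y + z • u ∈ B → (y + z • u ∈ Ω ↔ z < b)) :
    ∫ z : ℝ, Ω.indicator (fun x => lineDeriv ℝ f x u) (y + z • u) = f (y + b • u) := by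
  obtain ⟨R, hR⟩ := exists_forall_le_abs_notMem hB hu y
  set a : ℝ := min b (-|R|) with ha
  have ha' : ∀ z : ℝ, z ≤ a → y + z • u ∉ B := by
    intro z hz
    apply hR
    have h1 : z ≤ -|R| := hz.trans (min_le_right _ _)
    have h2 : |R| ≤ |z| := by
      rw [abs_of_nonpos (h1.trans (by simp))]
      linarith
    exact (le_abs_self R).trans h2
  have hout : ∀ z : ℝ, y + z • u ∉ B → lineDeriv ℝ f (y + z • u) u = 0 := fun z hz =>
    lineDeriv_eq_zero_of_notMem_tsupport (fun h => hz (hfB h)) u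
  rw [← integral_deriv_line hf hfB y u (min_le_left b (-|R|))
    (fun z hz hzB => (hin z hzB).2 hz) (ha' a le_rfl),
    intervalIntegral.integral_of_le (min_le_left b (-|R|)),
    ← integral_Ioc_eq_integral_Ioo.symm, ← integral_indicator measurableSet_Ioo]
  congr 1
  ext z
  rw [← ha]
  by_cases hzB : y + z • u ∈ B
  · have haz : a < z := by
      by_contra h
      exact ha' z (not_lt.1 h) hzB
    by_cases hzb : z < b
    · rw [indicator_of_mem ((hin z hzB).2 hzb), indicator_of_mem (show z ∈ Ioo a b from ⟨haz, hzb⟩),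
        lineDeriv_eq_deriv_line]
    · rw [indicator_of_notMem (fun h => hzb ((hin z hzB).1 h)),
        indicator_of_notMem (fun h : z ∈ Ioo a b => hzb h.2)]
  · have h0 := hout z hzB
    have e1 : Ω.indicator (fun x => lineDeriv ℝ f x u) (y + z • u) = 0 := by
      by_cases h : y + z • u ∈ Ω
      · rw [indicator_of_mem h, h0]
      · rw [indicator_of_notMem h]
    rw [e1]
    by_cases h : z ∈ Ioo a b
    · rw [indicator_of_mem h, ← lineDeriv_eq_deriv_line, h0]
    · rw [indicator_of_notMem h]

/-- On a line that does not cross the boundary of `Ω` inside `B` the integral vanishes. -/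
theorem integral_indicator_line_of_forall (hf : PointwiseLipschitzIn Ω f) (hfB : tsupport f ⊆ B)
    (hB : Bornology.IsBounded B) {y u : Space p} (hu : u ≠ 0)
    (hin : (∀ z : ℝ, y + z • u ∈ B → y + z • u ∈ Ω) ∨ (∀ z : ℝ, y + z • u ∈ B → y + z • u ∉ Ω)) :
    ∫ z : ℝ, Ω.indicator (fun x => lineDeriv ℝ f x u) (y + z • u) = 0 := by
  obtain ⟨R, hR⟩ := exists_forall_le_abs_notMem hB hu y
  -- beyond `|z| = R` the line is outside `B`, so that it may be considered to end at `b`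
  have key : ∀ b : ℝ, R ≤ |b| → (∀ z, y + z • u ∈ B → (y + z • u ∈ Ω ↔ z < b)) →
      ∫ z : ℝ, Ω.indicator (fun x => lineDeriv ℝ f x u) (y + z • u) = 0 := fun b hb h => by
    rw [integral_indicator_line_of_mem hf hfB hB hu h]
    exact image_eq_zero_of_notMem_tsupport fun h => hR b hb (hfB h)
  rcases hin with hin | hin
  · refine key |R| ((le_abs_self R).trans (le_abs_self _)) fun z hz => ⟨fun _ => ?_, fun _ => hin z hz⟩
    by_contra hcon
    exact hR z (((le_abs_self R).trans (not_lt.1 hcon)).trans (le_abs_self z)) hz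
  · refine key (-|R|) (by rw [abs_neg, abs_abs]; exact le_abs_self R) fun z hz =>
      ⟨fun h => absurd h (hin z hz), fun h => ?_⟩
    refine absurd hz (hR z ?_)
    rw [abs_of_nonpos ((le_of_lt h).trans (by simp))]
    have := le_abs_self R
    linarith

end Lines

/-! ### Almost isometric changes of variable -/

section Comparison

/-- Two measures that bound each other up to the factor `1 + δ` have integrals that differ by at
most the relative error `δ`. -/
theorem abs_integral_sub_integral_le {α : Type*} [MeasurableSpace α] {κ H : Measure α} {δ : ℝ}
    (hδ : 0 ≤ δ) (h1 : κ ≤ ENNReal.ofReal (1 + δ) • H) (h2 : H ≤ ENNReal.ofReal (1 + δ) • κ)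
    {f : α → ℝ} (hf : Integrable f H) :
    |∫ x, f x ∂κ - ∫ x, f x ∂H| ≤ δ * ∫ x, |f x| ∂H := by
  have hf' : Integrable f κ := (hf.smul_measure ENNReal.ofReal_ne_top).mono_measure h1
  have key : ∀ g : α → ℝ, (∀ x, 0 ≤ g x) → Integrable g H → Integrable g κ →
      |∫ x, g x ∂κ - ∫ x, g x ∂H| ≤ δ * ∫ x, g x ∂H := by
    intro g hg hgH hgκ
    have e1 : ∫ x, g x ∂κ ≤ (1 + δ) * ∫ x, g x ∂H := by
      have := integral_mono_measure h1 (ae_of_all _ hg) (hgH.smul_measure ENNReal.ofReal_ne_top)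
      rwa [integral_smul_measure, ENNReal.toReal_ofReal (by linarith), smul_eq_mul] at this
    have e2 : ∫ x, g x ∂H ≤ (1 + δ) * ∫ x, g x ∂κ := by
      have := integral_mono_measure h2 (ae_of_all _ hg) (hgκ.smul_measure ENNReal.ofReal_ne_top)
      rwa [integral_smul_measure, ENNReal.toReal_ofReal (by linarith), smul_eq_mul] at this
    have e3 : 0 ≤ ∫ x, g x ∂H := integral_nonneg hg
    rw [abs_le]
    constructor
    · -- `∫ g ∂κ < (1 - δ) ∫ g ∂H` contradicts `e2`, because `(1 + δ) (1 - δ) ≤ 1`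
      by_contra hcon
      nlinarith [mul_nonneg hδ e3, mul_nonneg hδ (mul_nonneg hδ e3)]
    · linarith
  have hp := key (fun x => max (f x) 0) (fun x => le_max_right _ _) hf.pos_part hf'.pos_part
  have hn := key (fun x => max (-f x) 0) (fun x => le_max_right _ _) hf.neg_part hf'.neg_part
  have ef : ∀ x, f x = max (f x) 0 - max (-f x) 0 := fun x => by
    rcases le_total 0 (f x) with h | h <;> simp [h]
  have ea : ∀ x, |f x| = max (f x) 0 + max (-f x) 0 := fun x => by
    rcases le_total 0 (f x) with h | h <;> simp [h, abs_of_nonneg, abs_of_nonpos]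
  have s1 : ∫ x, f x ∂κ = ∫ x, max (f x) 0 ∂κ - ∫ x, max (-f x) 0 ∂κ := by
    rw [← integral_sub hf'.pos_part hf'.neg_part]; exact integral_congr_ae (ae_of_all _ ef)
  have s2 : ∫ x, f x ∂H = ∫ x, max (f x) 0 ∂H - ∫ x, max (-f x) 0 ∂H := by
    rw [← integral_sub hf.pos_part hf.neg_part]; exact integral_congr_ae (ae_of_all _ ef)
  have s3 : ∫ x, |f x| ∂H = ∫ x, max (f x) 0 ∂H + ∫ x, max (-f x) 0 ∂H := by
    rw [← integral_add hf.pos_part hf.neg_part]; exact integral_congr_ae (ae_of_all _ ea)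
  rw [s1, s2, s3]
  rw [abs_le] at *
  constructor <;> linarith [hp.1, hp.2, hn.1, hn.2]

variable {X Y : Type*} [MetricSpace X] [MeasurableSpace X] [BorelSpace X]
  [MetricSpace Y] [MeasurableSpace Y] [BorelSpace Y]

theorem euclideanHausdorffMeasure_image_le {e : X → Y} {K : NNReal} (he : LipschitzWith K e)
    (d : ℕ) (A : Set X) : (μHE[d] : Measure Y) (e '' A) ≤ (K : ENNReal) ^ d * μHE[d] A := by
  have := he.hausdorffMeasure_image_le (d := d) (by positivity) A
  simp only [Measure.euclideanHausdorffMeasure_def, Measure.smul_apply, ENNReal.smul_def,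
    smul_eq_mul, ENNReal.rpow_natCast] at this ⊢
  calc _ ≤ _ := mul_le_mul_right this _
    _ = _ := by ring

theorem le_euclideanHausdorffMeasure_image {e : X → Y} {K : NNReal} (he : AntilipschitzWith K e)
    (d : ℕ) (A : Set X) : (μHE[d] : Measure X) A ≤ (K : ENNReal) ^ d * μHE[d] (e '' A) := by
  have := he.le_hausdorffMeasure_image (d := d) (by positivity) A
  simp only [Measure.euclideanHausdorffMeasure_def, Measure.smul_apply, ENNReal.smul_def,
    smul_eq_mul, ENNReal.rpow_natCast] at this ⊢
  calc _ ≤ _ := mul_le_mul_right this _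
    _ = _ := by ring

/-- Integration over a `d`-dimensional set `Γ` may be replaced, with a small relative error, by
integration over its image under an almost isometric map to a `d`-dimensional Euclidean space. -/
theorem abs_integral_image_sub_le {p : ℕ} {V : Type*} [NormedAddCommGroup V]
    [InnerProductSpace ℝ V] [FiniteDimensional ℝ V] [MeasurableSpace V] [BorelSpace V]
    {d : ℕ} (hd : finrank ℝ V = d)
    {Γ : Set (Space p)} (hΓ : MeasurableSet Γ) {P : Space p → V} {K L : NNReal} {δ : ℝ}
    (hδ : 0 ≤ δ) (hK : LipschitzWith K (fun x : Γ => P x))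
    (hL : AntilipschitzWith L (fun x : Γ => P x))
    (hKδ : (K : ℝ) ^ d ≤ 1 + δ) (hLδ : (L : ℝ) ^ d ≤ 1 + δ)
    {f : Space p → ℝ} (hf : IntegrableOn f Γ μHE[d]) {G : V → ℝ}
    (hG : ∀ x ∈ Γ, G (P x) = f x) (hG0 : ∀ y ∉ P '' Γ, G y = 0) :
    |(∫ y, G y) - ∫ x in Γ, f x ∂μHE[d]| ≤ δ * ∫ x in Γ, |f x| ∂μHE[d] := by
  set e : Γ → V := fun x => P x with he
  have hemb : MeasurableEmbedding e := by
    have := hΓ.standardBorel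
    exact hK.continuous.measurable.measurableEmbedding hL.injective
  have hrange : range e = P '' Γ := by
    ext y; simp [e]
  have hvol : (volume : Measure V) = μHE[d] := by
    rw [← hd, InnerProductSpace.euclideanHausdorffMeasure_eq_volume]
  have ofReal_pow : ∀ M : NNReal, (M : ℝ) ^ d ≤ 1 + δ → (M : ENNReal) ^ d ≤ ENNReal.ofReal (1 + δ) := by
    intro M hM
    rw [← ENNReal.ofReal_coe_nnreal, ← ENNReal.ofReal_pow M.coe_nonneg]
    exact ENNReal.ofReal_le_ofReal hM
  have hcomp1 : Measure.comap e volume ≤ ENNReal.ofReal (1 + δ) • (μHE[d] : Measure Γ) := by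
    refine Measure.le_iff.2 fun A hA => ?_
    rw [hemb.comap_apply, Measure.smul_apply, smul_eq_mul, hvol]
    exact (euclideanHausdorffMeasure_image_le hK d A).trans (mul_le_mul_left (ofReal_pow K hKδ) _)
  have hcomp2 : (μHE[d] : Measure Γ) ≤ ENNReal.ofReal (1 + δ) • Measure.comap e volume := by
    refine Measure.le_iff.2 fun A hA => ?_
    rw [Measure.smul_apply, smul_eq_mul, hemb.comap_apply, hvol]
    exact (le_euclideanHausdorffMeasure_image hL d A).trans (mul_le_mul_left (ofReal_pow L hLδ) _)
  have hval : MeasurableEmbedding (Subtype.val : Γ → Space p) := MeasurableEmbedding.subtype_coe hΓ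
  have hmap : Measure.map (Subtype.val : Γ → Space p) μHE[d] =
      (μHE[d] : Measure (Space p)).restrict Γ := by
    rw [isometry_subtype_coe.map_euclideanHausdorffMeasure, Subtype.range_coe]
  have hsub : ∀ g : Space p → ℝ, ∫ x in Γ, g x ∂μHE[d] = ∫ x : Γ, g x ∂μHE[d] := fun g => by
    rw [← hmap, hval.integral_map]
  have hintΓ : Integrable (fun x : Γ => f x) μHE[d] := by
    rw [IntegrableOn, ← hmap, hval.integrable_map_iff] at hf
    exact hf
  have hGint : ∫ y, G y = ∫ x : Γ, f x ∂(Measure.comap e volume) := by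
    have h1 : ∫ y, G y = ∫ y in range e, G y := by
      rw [setIntegral_eq_integral_of_forall_compl_eq_zero]
      intro y hy
      exact hG0 y (hrange ▸ hy)
    rw [h1, ← hemb.map_comap, hemb.integral_map]
    exact integral_congr_ae (ae_of_all _ fun x => hG x x.2)
  rw [hGint, hsub, hsub]
  exact abs_integral_sub_integral_le hδ hcomp1 hcomp2 hintΓ

end Comparison

/-! ### The flux through a nearly flat piece of boundary -/

section Flat

variable {p : ℕ} {Ω : Set (Space p)} {f : Space p → ℝ}

/-- Where the boundary of `Ω` is `ε`-close to a hyperplane with normal `ν`, and `⟨ν, u⟩ = 1`, the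
integral of the derivative in the direction `u` is the boundary integral up to a small relative
error. Integrating along the lines parallel to `u` yields an integral over the projection of the
boundary along `u`, and this projection is almost isometric. -/
theorem abs_integral_lineDeriv_sub_le (hp : 1 ≤ p) {B : Set (Space p)} {ρ : Space p → ℝ}
    {ν u : Space p} {ε δ M : ℝ} (hν : ‖ν‖ = 1) (hu : inner ℝ ν u = 1) (huM : ‖u‖ ≤ M)
    (hε : 0 ≤ ε) (hεM : ε * M < 1) (hδ : 0 ≤ δ) (hK : (1 + ε * M) ^ (p - 1) ≤ 1 + δ)
    (hL : ((1 - ε * M)⁻¹) ^ (p - 1) ≤ 1 + δ)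
    (hΩo : IsOpen Ω) (hΩb : Bornology.IsBounded Ω)
    (hfin : (μHE[p - 1] : Measure (Space p)) (frontier Ω) < ⊤)
    (hBo : IsOpen B) (hBc : Convex ℝ B) (hBb : Bornology.IsBounded B) (hρ : ContinuousOn ρ B)
    (hflat : ∀ x ∈ B, ∀ x' ∈ B, |ρ x - ρ x' - inner ℝ ν (x - x')| ≤ ε * ‖x - x'‖)
    (hmem : ∀ x ∈ B, x ∈ Ω ↔ ρ x < 0) (hfr : ∀ x ∈ B, x ∈ frontier Ω ↔ ρ x = 0)
    (hf : PointwiseLipschitzIn Ω f) (hfB : tsupport f ⊆ B) :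
    |∫ x in Ω, lineDeriv ℝ f x u ∂volume - ∫ x in frontier Ω, f x ∂μHE[p - 1]| ≤
      δ * ∫ x in frontier Ω, |f x| ∂μHE[p - 1] := by
  have hM : 0 ≤ M := (norm_nonneg u).trans huM
  have hu0 : u ≠ 0 := by rintro rfl; simp at hu
  set Γ : Set (Space p) := frontier Ω ∩ B with hΓdef
  have hΓ : MeasurableSet Γ := isClosed_frontier.measurableSet.inter hBo.measurableSet
  have hf0 : ∀ x, x ∉ B → f x = 0 := fun x hx =>
    image_eq_zero_of_notMem_tsupport fun h => hx (hfB h)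
  have hsub : ∀ g : Space p → ℝ, (∀ x, x ∉ B → g x = 0) →
      ∫ x in frontier Ω, g x ∂μHE[p - 1] = ∫ x in Γ, g x ∂μHE[p - 1] := by
    intro g hg
    refine setIntegral_eq_of_subset_of_forall_sdiff_eq_zero isClosed_frontier.measurableSet
      inter_subset_left fun x hx => hg x fun h => hx.2 ⟨hx.1, h⟩
  rw [hsub f hf0, hsub (fun x => |f x|) fun x hx => by simp [hf0 x hx]]
  -- `ρ` increases along `u`
  have hmono : ∀ x ∈ B, ∀ z : ℝ, 0 < z → x + z • u ∈ B → ρ x < ρ (x + z • u) := by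
    intro x hx z hz hxz
    have h1 := (abs_le.1 (hflat _ hxz x hx)).1
    rw [add_sub_cancel_left, real_inner_smul_right, hu, norm_smul, Real.norm_eq_abs,
      abs_of_pos hz] at h1
    have h2 : ε * (z * ‖u‖) ≤ z * (ε * M) := by
      calc ε * (z * ‖u‖) = z * (ε * ‖u‖) := by ring
        _ ≤ _ := by gcongr
    nlinarith
  have hperp : ∀ x : Space p, x - (inner ℝ ν x : ℝ) • u ∈ (ℝ ∙ ν)ᗮ := by
    intro x
    rw [Submodule.mem_orthogonal_singleton_iff_inner_right, inner_sub_right,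
      real_inner_smul_right, hu, mul_one, sub_self]
  -- the projection to the hyperplane `νᗮ` along `u`
  set P : Space p → (ℝ ∙ ν)ᗮ := fun x => ⟨x - (inner ℝ ν x : ℝ) • u, hperp x⟩ with hP
  have hPx : ∀ x, ((P x : Space p)) + (inner ℝ ν x : ℝ) • u = x := fun x => by simp [hP]
  -- the integrals along the lines parallel to `u`
  set G : (ℝ ∙ ν)ᗮ → ℝ := fun y =>
    ∫ z : ℝ, Ω.indicator (fun x => lineDeriv ℝ f x u) ((y : Space p) + z • u) with hGdef
  have hGint : ∫ x in Ω, lineDeriv ℝ f x u = ∫ y, G y := by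
    rw [← integral_indicator hΩo.measurableSet]
    exact integral_eq_integral_skewCoord hν hu
      ((hf.integrableOn_lineDeriv hΩo hΩb u).integrable_indicator hΩo.measurableSet)
  have hG : ∀ x ∈ Γ, G (P x) = f x := by
    intro x hx
    have hx0 : ρ x = 0 := (hfr x hx.2).1 hx.1
    change ∫ z : ℝ, Ω.indicator (fun x => lineDeriv ℝ f x u) ((P x : Space p) + z • u) = f x
    rw [integral_indicator_line_of_mem hf hfB hBb hu0 (b := inner ℝ ν x), hPx]
    intro z hz
    have e1 : (P x : Space p) + z • u = x + (z - inner ℝ ν x) • u := by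
      conv_rhs => rw [← hPx x]
      rw [sub_smul, hPx]
      nth_rewrite 2 [← hPx x]
      abel
    rw [hmem _ hz]
    rw [e1] at hz ⊢
    rcases lt_trichotomy z (inner ℝ ν x) with h | h | h
    · refine ⟨fun _ => h, fun _ => ?_⟩
      have := hmono _ hz (inner ℝ ν x - z) (sub_pos.2 h) (by
        rw [add_assoc, ← add_smul]; simpa using hx.2)
      rw [add_assoc, ← add_smul] at this
      simpa [hx0] using this
    · simp [h, hx0]
    · refine ⟨fun h' => ?_, fun h' => absurd h' (not_lt.2 h.le)⟩
      have := hmono x hx.2 (z - inner ℝ ν x) (sub_pos.2 h) hz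
      linarith
  have hG0 : ∀ y ∉ P '' Γ, G y = 0 := by
    intro y hy
    have hno : ∀ z : ℝ, (y : Space p) + z • u ∈ B → ρ ((y : Space p) + z • u) ≠ 0 := by
      intro z hz h0
      refine hy ⟨(y : Space p) + z • u, ⟨(hfr _ hz).2 h0, hz⟩, ?_⟩
      have hyν : inner ℝ ν (y : Space p) = 0 :=
        Submodule.mem_orthogonal_singleton_iff_inner_right.1 y.2
      ext1
      simp [hP, inner_add_right, real_inner_smul_right, hu, hyν]
    apply integral_indicator_line_of_forall hf hfB hBb hu0
    by_contra! hcon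
    obtain ⟨⟨z₁, h1, h1'⟩, ⟨z₂, h2, h2'⟩⟩ := hcon
    have hline : Continuous fun z : ℝ => (y : Space p) + z • u := by fun_prop
    have hconv : Convex ℝ {z : ℝ | (y : Space p) + z • u ∈ B} := by
      intro a ha b hb s t hs ht hst
      have := hBc ha hb hs ht hst
      change _ ∈ B
      convert this using 1
      rw [smul_add, smul_add, smul_smul, smul_smul, add_add_add_comm, ← add_smul, hst, one_smul,
        ← add_smul]
      rfl
    have hcont : ContinuousOn (fun z : ℝ => ρ ((y : Space p) + z • u))
        {z : ℝ | (y : Space p) + z • u ∈ B} :=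
      hρ.comp hline.continuousOn fun z hz => hz
    have hneg : ρ ((y : Space p) + z₂ • u) < 0 := (hmem _ h2).1 h2'
    have hpos : 0 ≤ ρ ((y : Space p) + z₁ • u) := not_lt.1 fun h => h1' ((hmem _ h1).2 h)
    obtain ⟨z, hz, hz0⟩ := hconv.isPreconnected.intermediate_value h2 h1 hcont ⟨hneg.le, hpos⟩
    exact hno z hz hz0
  -- differences of boundary points are almost orthogonal to `ν`
  have hν' : ∀ x ∈ Γ, ∀ x' ∈ Γ, ‖(inner ℝ ν (x - x') : ℝ) • u‖ ≤ ε * M * ‖x - x'‖ := by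
    intro x hx x' hx'
    have h1 := hflat x hx.2 x' hx'.2
    rw [(hfr x hx.2).1 hx.1, (hfr x' hx'.2).1 hx'.1, sub_zero, zero_sub, abs_neg] at h1
    rw [norm_smul, Real.norm_eq_abs]
    calc _ ≤ (ε * ‖x - x'‖) * M := mul_le_mul h1 huM (norm_nonneg _) (by positivity)
      _ = _ := by ring
  have hdiff : ∀ x x' : Space p, ‖P x - P x'‖ = ‖(x - x') - (inner ℝ ν (x - x') : ℝ) • u‖ := by
    intro x x'
    rw [← Submodule.norm_coe, Submodule.coe_sub, hP]
    simp only [inner_sub_right, sub_smul]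
    congr 1
    abel
  have hKL : LipschitzWith (1 + ε * M).toNNReal (fun x : Γ => P x) := by
    apply LipschitzWith.of_dist_le_mul
    intro x x'
    rw [Real.coe_toNNReal _ (by positivity), dist_eq_norm, hdiff, Subtype.dist_eq, dist_eq_norm]
    have := hν' x x.2 x' x'.2
    linarith [norm_sub_le ((x : Space p) - x') ((inner ℝ ν ((x : Space p) - x') : ℝ) • u)]
  have hLL : AntilipschitzWith ((1 - ε * M)⁻¹).toNNReal (fun x : Γ => P x) := by
    apply AntilipschitzWith.of_le_mul_dist
    intro x x'
    have hpos : 0 < 1 - ε * M := by linarith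
    rw [Real.coe_toNNReal _ (by positivity), dist_eq_norm (P x), hdiff, Subtype.dist_eq,
      dist_eq_norm, inv_mul_eq_div, le_div_iff₀ hpos]
    have := hν' x x.2 x' x'.2
    linarith [norm_sub_norm_le ((x : Space p) - x') ((inner ℝ ν ((x : Space p) - x') : ℝ) • u)]
  have hrank : finrank ℝ (ℝ ∙ ν)ᗮ = p - 1 := by
    have : Fact (finrank ℝ (Space p) = (p - 1) + 1) :=
      ⟨by rw [finrank_euclideanSpace_fin]; omega⟩
    exact Submodule.finrank_orthogonal_span_singleton (by rintro rfl; simp at hν)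
  have hfint : IntegrableOn f Γ μHE[p - 1] := by
    obtain ⟨A, hA⟩ := hΩb.isCompact_closure.exists_bound_of_continuousOn hf.continuous.continuousOn
    refine Measure.integrableOn_of_bounded (M := A)
      ((measure_mono inter_subset_left).trans_lt hfin).ne hf.continuous.aestronglyMeasurable ?_
    filter_upwards [ae_restrict_mem hΓ] with x hx
    exact hA x (frontier_subset_closure hx.1)
  rw [hGint]
  refine abs_integral_image_sub_le hrank hΓ hδ hKL hLL ?_ ?_ hfint hG hG0
  · rwa [Real.coe_toNNReal _ (by positivity)]
  · rwa [Real.coe_toNNReal _ (by have : 0 < 1 - ε * M := by linarith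
                                 positivity)]

end Flat

/-! ### The divergence theorem near a regular boundary point -/

section Localization

variable {p : ℕ} {Ω : Set (Space p)} {f g : Space p → ℝ}

/-- The difference of the two sides of the divergence theorem for the field `f v`, with `v`
a constant vector. -/
noncomputable def divergenceDefect (Ω : Set (Space p)) (v : Space p) (f : Space p → ℝ) : ℝ :=
  ∫ x in Ω, lineDeriv ℝ f x v ∂volume -
    ∫ x in frontier Ω, f x * inner ℝ (outwardNormal Ω x) v ∂(μHE[p - 1] : Measure (Space p))

theorem IsPiecewiseC1Domain.integrableOn_frontier (h : IsPiecewiseC1Domain Ω)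
    (hf : Continuous f) : IntegrableOn f (frontier Ω) (μHE[p - 1] : Measure (Space p)) := by
  obtain ⟨A, hA⟩ := h.isBounded.isCompact_closure.exists_bound_of_continuousOn hf.continuousOn
  refine Measure.integrableOn_of_bounded (M := A) h.area_lt_top.ne hf.aestronglyMeasurable ?_
  filter_upwards [ae_restrict_mem isClosed_frontier.measurableSet] with x hx
  exact hA x (frontier_subset_closure hx)

theorem IsPiecewiseC1Domain.integrableOn_mul_normal (h : IsPiecewiseC1Domain Ω)
    (hf : Continuous f) (v : Space p) :
    IntegrableOn (fun x => f x * inner ℝ (outwardNormal Ω x) v) (frontier Ω)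
      (μHE[p - 1] : Measure (Space p)) := by
  refine Integrable.mono ((h.integrableOn_frontier hf).mul_const ‖v‖)
    (hf.aestronglyMeasurable.mul
      (h.aestronglyMeasurable_outwardNormal.inner aestronglyMeasurable_const)) ?_
  refine ae_of_all _ fun x => ?_
  rw [norm_mul, norm_mul, norm_norm]
  refine mul_le_mul_of_nonneg_left ?_ (norm_nonneg _)
  calc _ ≤ ‖outwardNormal Ω x‖ * ‖v‖ := norm_inner_le_norm _ _
    _ ≤ 1 * ‖v‖ := by gcongr; exact norm_outwardNormal_le Ω x
    _ = _ := one_mul _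

theorem divergenceDefect_add (h : IsPiecewiseC1Domain Ω) (hf : PointwiseLipschitzIn Ω f)
    (hg : PointwiseLipschitzIn Ω g) (v : Space p) :
    divergenceDefect Ω v (fun x => f x + g x) =
      divergenceDefect Ω v f + divergenceDefect Ω v g := by
  have h1 : ∫ x in Ω, lineDeriv ℝ (fun x => f x + g x) x v =
      (∫ x in Ω, lineDeriv ℝ f x v) + ∫ x in Ω, lineDeriv ℝ g x v := by
    rw [← integral_add (hf.integrableOn_lineDeriv h.isOpen h.isBounded v)
      (hg.integrableOn_lineDeriv h.isOpen h.isBounded v)]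
    refine setIntegral_congr_ae h.isOpen.measurableSet ?_
    filter_upwards [hf.ae_differentiableAt, hg.ae_differentiableAt] with x hfx hgx hx
    rw [(hfx hx).lineDeriv_eq_fderiv, (hgx hx).lineDeriv_eq_fderiv,
      ((hfx hx).fun_add (hgx hx)).lineDeriv_eq_fderiv, fderiv_fun_add (hfx hx) (hgx hx)]
    rfl
  have h2 : ∫ x in frontier Ω, (f x + g x) * inner ℝ (outwardNormal Ω x) v
      ∂(μHE[p - 1] : Measure (Space p)) =
      ∫ x in frontier Ω, f x * inner ℝ (outwardNormal Ω x) v ∂(μHE[p - 1] : Measure (Space p)) +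
      ∫ x in frontier Ω, g x * inner ℝ (outwardNormal Ω x) v
        ∂(μHE[p - 1] : Measure (Space p)) := by
    rw [← integral_add (h.integrableOn_mul_normal hf.continuous v)
      (h.integrableOn_mul_normal hg.continuous v)]
    simp only [add_mul]
  rw [divergenceDefect, h1, h2, divergenceDefect, divergenceDefect]
  ring

/-- The flatness parameter can be chosen so that the projections distort `d`-dimensional measure
by a factor of at most `1 + δ`. -/
theorem exists_flatness (d : ℕ) (M : ℝ) {δ : ℝ} (hδ : 0 < δ) :
    ∃ ε : ℝ, 0 < ε ∧ ε * M < 1 ∧ (1 + ε * M) ^ d ≤ 1 + δ ∧ ((1 - ε * M)⁻¹) ^ d ≤ 1 + δ := by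
  have h1 : ∀ᶠ ε in 𝓝 (0 : ℝ), ε * M < 1 :=
    (Continuous.tendsto (f := fun ε : ℝ => ε * M) (by fun_prop) 0).eventually_lt_const (by simp)
  have h2 : ∀ᶠ ε in 𝓝 (0 : ℝ), (1 + ε * M) ^ d < 1 + δ :=
    (Continuous.tendsto (f := fun ε : ℝ => (1 + ε * M) ^ d) (by fun_prop) 0).eventually_lt_const
      (by simpa using hδ)
  have h3 : ∀ᶠ ε in 𝓝 (0 : ℝ), ((1 - ε * M)⁻¹) ^ d < 1 + δ := by
    have : ContinuousAt (fun ε : ℝ => ((1 - ε * M)⁻¹) ^ d) 0 :=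
      ((ContinuousAt.inv₀ (by fun_prop) (by simp)).pow d)
    exact this.tendsto.eventually_lt_const (by simpa using hδ)
  obtain ⟨ε, ⟨h1, h2, h3⟩, h0⟩ :=
    (((h1.and (h2.and h3)).filter_mono nhdsWithin_le_nhds).and
      (self_mem_nhdsWithin (a := (0 : ℝ)) (s := Ioi 0))).exists
  exact ⟨ε, h0, h1, h2.le, h3.le⟩

/-- Near a regular boundary point the boundary is as flat as desired. Splitting `v` into two
vectors transversal to the boundary, for which `abs_integral_lineDeriv_sub_le` applies, gives the
divergence theorem up to a small relative error. -/
theorem exists_nhds_abs_divergenceDefect_le (hp : 1 ≤ p) (h : IsPiecewiseC1Domain Ω)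
    {x₀ ν : Space p} (hν : IsOutwardNormal Ω x₀ ν) (v : Space p) {η : ℝ} (hη : 0 < η) :
    ∃ U, IsOpen U ∧ x₀ ∈ U ∧ ∀ f, PointwiseLipschitzIn Ω f → tsupport f ⊆ U →
      |divergenceDefect Ω v f| ≤
        η * ∫ x in frontier Ω, |f x| ∂(μHE[p - 1] : Measure (Space p)) := by
  have hν1 := hν.norm_eq_one
  have hνeq := hν.outwardNormal_eq
  obtain ⟨U₁, hU₁, hxU₁, -, hnc⟩ := hν.exists_nhds h.isOpen
  obtain ⟨U, ρ, hU, hxU, hρ, hg, hΩ, h0, hνρ⟩ := hν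
  set a : ℝ := inner ℝ ν v with ha
  -- `M` bounds the transversal vectors `ν` and `ν + (v - ⟨ν, v⟩ ν)` that are used below
  set M : ℝ := 1 + 2 * ‖v‖ with hM
  have haM : |a| ≤ ‖v‖ := by
    have := abs_real_inner_le_norm ν v
    rwa [hν1, one_mul] at this
  -- `v` is the second of these minus `1 - a` times the first: this costs `(1 + |1 - a|) δ = η / 2`
  set δ : ℝ := η / (2 * (1 + |1 - a|)) with hδdef
  have hδ : 0 < δ := by positivity
  obtain ⟨ε, hε, hεM, hK, hL⟩ := exists_flatness (p - 1) M hδ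
  have hgpos : 0 < ‖gradient ρ x₀‖ := norm_pos_iff.2 (hg x₀ hxU)
  -- the normalized defining function and its flatness near `x₀`
  have hstrict : HasStrictFDerivAt (fun x => ‖gradient ρ x₀‖⁻¹ * ρ x)
      (‖gradient ρ x₀‖⁻¹ • fderiv ℝ ρ x₀) x₀ :=
    ((hρ.contDiffAt (hU.mem_nhds hxU)).hasStrictFDerivAt (by norm_num)).const_mul _
  have hfd : ∀ w, (‖gradient ρ x₀‖⁻¹ • fderiv ℝ ρ x₀) w = inner ℝ ν w := by
    intro w
    rw [hνρ, real_inner_smul_left, smul_apply, smul_eq_mul,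
      inner_gradient_left]
  have hlocal : ∀ᶠ q : Space p × Space p in 𝓝 (x₀, x₀),
      |‖gradient ρ x₀‖⁻¹ * ρ q.1 - ‖gradient ρ x₀‖⁻¹ * ρ q.2 - inner ℝ ν (q.1 - q.2)| ≤
        ε * ‖q.1 - q.2‖ := by
    filter_upwards [hstrict.isLittleO.def hε] with q hq
    rwa [hfd, Real.norm_eq_abs] at hq
  obtain ⟨r₁, hr₁, hball₁⟩ := Metric.eventually_nhds_iff_ball.1 hlocal
  obtain ⟨r₂, hr₂, hball₂⟩ := Metric.isOpen_iff.1 hU x₀ hxU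
  obtain ⟨r₃, hr₃, hball₃⟩ : ∃ r > 0, ∀ x ∈ Metric.ball x₀ r ∩ frontier Ω,
      |inner ℝ (outwardNormal Ω x) v - a| ≤ η / 2 := by
    have hxf : x₀ ∈ frontier Ω := (mem_frontier_iff_of_defining h.isOpen hU hρ hg hΩ hxU).2 h0
    have hc : ContinuousWithinAt (fun x => |inner ℝ (outwardNormal Ω x) v - a|)
        (U₁ ∩ frontier Ω) x₀ := by
      have := hnc x₀ ⟨hxU₁, hxf⟩
      exact ((this.inner continuousWithinAt_const).sub continuousWithinAt_const).abs
    have hev := hc.tendsto.eventually_lt_const (u := η / 2) (by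
      rw [hνeq, ha, sub_self, abs_zero]; positivity)
    rw [inter_comm, nhdsWithin_inter_of_mem' (mem_nhdsWithin_of_mem_nhds (hU₁.mem_nhds hxU₁))] at hev
    obtain ⟨r, hr, hb⟩ := Metric.mem_nhdsWithin_iff.1 hev
    exact ⟨r, hr, fun x hx => le_of_lt (hb hx)⟩
  set B : Set (Space p) := Metric.ball x₀ (min r₁ (min r₂ r₃)) with hB
  have hBU : B ⊆ U := (Metric.ball_subset_ball ((min_le_right _ _).trans (min_le_left _ _))).trans
    hball₂
  have hmemB : ∀ x ∈ B, x ∈ Ω ↔ ‖gradient ρ x₀‖⁻¹ * ρ x < 0 := by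
    intro x hx
    rw [mul_neg_iff]
    have hpos : 0 < ‖gradient ρ x₀‖⁻¹ := inv_pos.2 hgpos
    constructor
    · intro hxΩ
      exact Or.inl ⟨hpos, (hΩ.subset ⟨hxΩ, hBU hx⟩).2⟩
    · rintro (h' | h')
      · exact (hΩ.symm.subset ⟨hBU hx, h'.2⟩).1
      · exact absurd h'.1 (not_lt.2 hpos.le)
  have hfrB : ∀ x ∈ B, x ∈ frontier Ω ↔ ‖gradient ρ x₀‖⁻¹ * ρ x = 0 := by
    intro x hx
    rw [mem_frontier_iff_of_defining h.isOpen hU hρ hg hΩ (hBU hx), mul_eq_zero]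
    simp [hgpos.ne']
  refine ⟨B, Metric.isOpen_ball, Metric.mem_ball_self (by positivity), fun f hf hfB => ?_⟩
  have hdir : ∀ u : Space p, inner ℝ ν u = 1 → ‖u‖ ≤ M →
      |∫ x in Ω, lineDeriv ℝ f x u ∂volume - ∫ x in frontier Ω, f x ∂μHE[p - 1]| ≤
        δ * ∫ x in frontier Ω, |f x| ∂μHE[p - 1] := by
    intro u hu huM
    refine abs_integral_lineDeriv_sub_le hp (B := B) (ρ := fun x => ‖gradient ρ x₀‖⁻¹ * ρ x)
      hν1 hu huM hε.le hεM hδ.le hK hL h.isOpen h.isBounded h.area_lt_top Metric.isOpen_ball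
      (convex_ball _ _) Metric.isBounded_ball
      (continuousOn_const.mul (hρ.continuousOn.mono hBU)) ?_ hmemB hfrB hf hfB
    intro x hx x' hx'
    refine hball₁ (x, x') ?_
    rw [← ball_prod_same]
    exact ⟨Metric.ball_subset_ball (min_le_left _ _) hx,
      Metric.ball_subset_ball (min_le_left _ _) hx'⟩
  have hνν : inner ℝ ν ν = (1 : ℝ) := by rw [real_inner_self_eq_norm_sq, hν1]; norm_num
  have d1 := hdir (ν + (v - a • ν))
    (by rw [inner_add_right, inner_sub_right, real_inner_smul_right, hνν, ha]; ring) (by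
      have e1 := norm_add_le ν (v - a • ν)
      have e2 := norm_sub_le v (a • ν)
      rw [norm_smul, hν1, Real.norm_eq_abs] at e2
      rw [hν1] at e1
      rw [hM]
      linarith)
  have d2 := hdir ν hνν (by rw [hν1, hM]; linarith [norm_nonneg v])
  -- `∂ᵥ f` as a combination of two transversal derivatives
  have hsplit : ∫ x in Ω, lineDeriv ℝ f x v = (∫ x in Ω, lineDeriv ℝ f x (ν + (v - a • ν))) -
      (1 - a) * ∫ x in Ω, lineDeriv ℝ f x ν := by
    rw [← integral_const_mul, ← integral_sub (hf.integrableOn_lineDeriv h.isOpen h.isBounded _)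
      ((hf.integrableOn_lineDeriv h.isOpen h.isBounded _).const_mul _)]
    refine setIntegral_congr_ae h.isOpen.measurableSet ?_
    filter_upwards [hf.ae_differentiableAt] with x hfx hx
    rw [(hfx hx).lineDeriv_eq_fderiv, (hfx hx).lineDeriv_eq_fderiv, (hfx hx).lineDeriv_eq_fderiv]
    simp only [map_add, map_sub, map_smul, smul_eq_mul]
    ring
  have hfi := h.integrableOn_frontier hf.continuous
  have hnormal : |∫ x in frontier Ω, f x * inner ℝ (outwardNormal Ω x) v ∂μHE[p - 1] -
      a * ∫ x in frontier Ω, f x ∂μHE[p - 1]| ≤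
      η / 2 * ∫ x in frontier Ω, |f x| ∂μHE[p - 1] := by
    rw [← integral_const_mul, ← integral_const_mul, ← integral_sub
      (h.integrableOn_mul_normal hf.continuous v) (hfi.const_mul a)]
    refine (abs_integral_le_integral_abs).trans
      (integral_mono_ae ((h.integrableOn_mul_normal hf.continuous v).sub (hfi.const_mul a)).abs
        (hfi.abs.const_mul _) ?_)
    filter_upwards [ae_restrict_mem isClosed_frontier.measurableSet] with x hx
    by_cases hxB : x ∈ B
    · have := hball₃ x ⟨Metric.ball_subset_ball ((min_le_right _ _).trans (min_le_right _ _)) hxB,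
        hx⟩
      calc |f x * inner ℝ (outwardNormal Ω x) v - a * f x|
          = |inner ℝ (outwardNormal Ω x) v - a| * |f x| := by rw [← abs_mul]; congr 1; ring
        _ ≤ _ := by gcongr
    · have : f x = 0 := image_eq_zero_of_notMem_tsupport fun h => hxB (hfB h)
      simp [this]
  rw [divergenceDefect, hsplit]
  set I := ∫ x in frontier Ω, |f x| ∂μHE[p - 1]
  set F := ∫ x in frontier Ω, f x ∂μHE[p - 1]
  set N := ∫ x in frontier Ω, f x * inner ℝ (outwardNormal Ω x) v ∂μHE[p - 1]
  set D₁ := ∫ x in Ω, lineDeriv ℝ f x (ν + (v - a • ν))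
  set D₂ := ∫ x in Ω, lineDeriv ℝ f x ν
  calc |D₁ - (1 - a) * D₂ - N| = |(D₁ - F) - (1 - a) * (D₂ - F) - (N - a * F)| := by
        congr 1; ring
    _ ≤ |D₁ - F| + |1 - a| * |D₂ - F| + |N - a * F| := by
        rw [← abs_mul]
        exact (abs_sub _ _).trans (by gcongr; exact abs_sub _ _)
    _ ≤ δ * I + |1 - a| * (δ * I) + η / 2 * I := by gcongr
    _ = η * I := by
        have : δ * (1 + |1 - a|) = η / 2 := by rw [hδdef]; field_simp
        linear_combination I * this

end Localization

/-! ### Localization away from the singular boundary -/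

section Partition

variable {p : ℕ} {Ω : Set (Space p)} {f : Space p → ℝ}

/-- A continuous function with a bounded pointwise Lipschitz constant everywhere is Lipschitz. -/
theorem lipschitzWith_of_pointwise {C : ℝ} (hC : 0 ≤ C) (hf : Continuous f)
    (h : ∀ x, ∀ᶠ y in 𝓝 x, |f y - f x| ≤ C * ‖y - x‖) : LipschitzWith C.toNNReal f := by
  apply LipschitzWith.of_dist_le_mul
  intro x y
  rw [Real.coe_toNNReal _ hC, dist_comm, dist_comm x, Real.dist_eq, dist_eq_norm]
  have hline : Continuous fun s : ℝ => x + s • (y - x) := by fun_prop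
  have key := abs_sub_le_of_pointwise_lipschitz (h := fun s : ℝ => f (x + s • (y - x)))
    (a := 0) (b := 1) (C := C * ‖y - x‖) zero_le_one (hf.comp hline).continuousOn ?_
  · simpa using key
  intro z _
  filter_upwards [(hline.tendsto z).eventually (h _)] with w hw
  refine hw.trans (le_of_eq ?_)
  rw [add_sub_add_left_eq_sub, ← sub_smul, norm_smul, Real.norm_eq_abs]
  ring

/-- With support inside `Ω` there is no boundary term, and integration by parts against the
constant `1` applies. -/
theorem divergenceDefect_eq_zero_of_tsupport_subset (h : IsPiecewiseC1Domain Ω)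
    (hf : PointwiseLipschitzIn Ω f) (hfΩ : tsupport f ⊆ Ω) (v : Space p) :
    divergenceDefect Ω v f = 0 := by
  obtain ⟨C, hC0, hC⟩ := hf.exists_bound_nonneg
  have hlip : LipschitzWith C.toNNReal f := by
    refine lipschitzWith_of_pointwise hC0 hf.continuous fun x => ?_
    by_cases hx : x ∈ tsupport f
    · exact hC x (hfΩ hx)
    · have hev := eventually_eq_zero_of_notMem_tsupport hx
      filter_upwards [hev] with y hy
      rw [hy, hev.self_of_nhds, sub_zero, abs_zero]
      positivity
  have hcs : HasCompactSupport f :=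
    h.isBounded.isCompact_closure.of_isClosed_subset (isClosed_tsupport f)
      (hfΩ.trans subset_closure)
  have h1 : ∫ x in Ω, lineDeriv ℝ f x v = 0 := by
    rw [setIntegral_eq_integral_of_forall_compl_eq_zero fun x hx =>
      lineDeriv_eq_zero_of_notMem_tsupport (fun h => hx (hfΩ h)) v]
    have := LipschitzWith.integral_lineDeriv_mul_eq (μ := (volume : Measure (Space p)))
      (LipschitzWith.const (1 : ℝ)) hlip hcs (-v)
    simpa [lineDeriv] using this.symm
  have h2 : ∫ x in frontier Ω, f x * inner ℝ (outwardNormal Ω x) v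
      ∂(μHE[p - 1] : Measure (Space p)) = 0 := by
    refine setIntegral_eq_zero_of_forall_eq_zero fun x hx => ?_
    have : x ∉ tsupport f := fun hx' => by
      rw [h.isOpen.frontier_eq] at hx
      exact hx.2 (hfΩ hx')
    rw [image_eq_zero_of_notMem_tsupport this, zero_mul]
  rw [divergenceDefect, h1, h2, sub_zero]

theorem divergenceDefect_eq_zero_of_disjoint (hfΩ : tsupport f ⊆ (closure Ω)ᶜ) (v : Space p) :
    divergenceDefect Ω v f = 0 := by
  have h1 : ∫ x in Ω, lineDeriv ℝ f x v = 0 :=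
    setIntegral_eq_zero_of_forall_eq_zero fun x hx =>
      lineDeriv_eq_zero_of_notMem_tsupport (fun h => hfΩ h (subset_closure hx)) v
  have h2 : ∫ x in frontier Ω, f x * inner ℝ (outwardNormal Ω x) v
      ∂(μHE[p - 1] : Measure (Space p)) = 0 := by
    refine setIntegral_eq_zero_of_forall_eq_zero fun x hx => ?_
    rw [image_eq_zero_of_notMem_tsupport fun h => hfΩ h (frontier_subset_closure hx), zero_mul]
  rw [divergenceDefect, h1, h2, sub_zero]

/-- A Lipschitz function with values in `[0, 1]` separating two compact sets. -/
theorem exists_lipschitz_separating {K₀ K₁ : Set (Space p)} (h0 : IsCompact K₀)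
    (h1 : IsCompact K₁) (hd : Disjoint K₀ K₁) :
    ∃ (χ : Space p → ℝ) (L : NNReal), LipschitzWith L χ ∧ (∀ x, 0 ≤ χ x ∧ χ x ≤ 1) ∧
      (∀ x ∈ K₀, ∀ᶠ y in 𝓝 x, χ y = 0) ∧ ∀ x ∈ K₁, ∀ᶠ y in 𝓝 x, χ y = 1 := by
  obtain ⟨r, hr, hdr⟩ := hd.exists_cthickenings h0 h1.isClosed
  have hr2 : 0 < r / 2 := by positivity
  refine ⟨fun x => thickenedIndicator hr2 (Metric.cthickening (r / 2) K₁) x, _,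
    LipschitzWith.of_dist_le_mul fun x y =>
      (lipschitzWith_thickenedIndicator hr2 (Metric.cthickening (r / 2) K₁)).dist_le_mul x y,
    fun x => ⟨NNReal.coe_nonneg _, by exact_mod_cast thickenedIndicator_le_one hr2 _ x⟩,
    fun x hx => ?_, fun x hx => ?_⟩
  · filter_upwards [Metric.isOpen_thickening.mem_nhds (Metric.self_subset_thickening hr K₀ hx)]
      with y hy
    rw [thickenedIndicator_zero hr2 _ fun hy' => ?_]
    · rfl
    · have h2 := Metric.thickening_cthickening_subset (r / 2) hr2.le K₁ hy'
      rw [add_halves] at h2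
      exact hdr.le_bot ⟨Metric.thickening_subset_cthickening _ _ hy,
        Metric.thickening_subset_cthickening _ _ h2⟩
  · filter_upwards [Metric.isOpen_thickening.mem_nhds (Metric.self_subset_thickening hr2 K₁ hx)]
      with y hy
    rw [thickenedIndicator_one hr2 _ (Metric.thickening_subset_cthickening _ _ hy)]
    rfl

/-- The estimate `|defect f| ≤ η ∫ |f|` passes from two open sets to their union without loss in
the constant: for `0 ≤ χ ≤ 1` the integrals of `|χ f|` and `|(1 - χ) f|` add up to that of `|f|`. -/
theorem abs_divergenceDefect_le_union (h : IsPiecewiseC1Domain Ω) {v : Space p} {η : ℝ}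
    {U₀ U₁ : Set (Space p)} (hU₀ : IsOpen U₀) (hU₁ : IsOpen U₁)
    (h0 : ∀ f, PointwiseLipschitzIn Ω f → HasCompactSupport f → tsupport f ⊆ U₀ →
      |divergenceDefect Ω v f| ≤ η * ∫ x in frontier Ω, |f x| ∂(μHE[p - 1] : Measure (Space p)))
    (h1 : ∀ f, PointwiseLipschitzIn Ω f → HasCompactSupport f → tsupport f ⊆ U₁ →
      |divergenceDefect Ω v f| ≤ η * ∫ x in frontier Ω, |f x| ∂(μHE[p - 1] : Measure (Space p)))
    (hf : PointwiseLipschitzIn Ω f) (hfc : HasCompactSupport f) (hfU : tsupport f ⊆ U₀ ∪ U₁) :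
    |divergenceDefect Ω v f| ≤
      η * ∫ x in frontier Ω, |f x| ∂(μHE[p - 1] : Measure (Space p)) := by
  obtain ⟨χ, L, hχ, hχ01, hχ0, hχ1⟩ := exists_lipschitz_separating
    (K₀ := tsupport f \ U₀) (K₁ := tsupport f \ U₁) (hfc.diff hU₀) (hfc.diff hU₁)
    (disjoint_left.2 fun x hx hx' => (hfU hx.1).elim hx.2 hx'.2)
  have hχ' : LipschitzWith L fun x => 1 - χ x := by
    apply LipschitzWith.of_dist_le_mul
    intro x y
    have := hχ.dist_le_mul x y
    rwa [dist_sub_left]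
  have hsub : ∀ ψ : Space p → ℝ, tsupport (fun x => ψ x * f x) ⊆ tsupport f := fun ψ =>
    closure_mono fun x hx => right_ne_zero_of_mul hx
  have hout : ∀ (ψ : Space p → ℝ) (x : Space p), (∀ᶠ y in 𝓝 x, ψ y = 0) →
      x ∉ tsupport (fun x => ψ x * f x) := fun ψ x hx => by
    rw [notMem_tsupport_iff_eventuallyEq]
    filter_upwards [hx] with y hy
    simp [hy]
  have hf0 := hf.lipschitz_mul h.isBounded hχ
  have hf1 := hf.lipschitz_mul h.isBounded hχ'
  have b0 := h0 _ hf0 (hfc.of_isClosed_subset (isClosed_tsupport _) (hsub _)) fun x hx => by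
    by_contra hxU
    exact hout χ x (hχ0 x ⟨hsub _ hx, hxU⟩) hx
  have b1 := h1 _ hf1 (hfc.of_isClosed_subset (isClosed_tsupport _) (hsub _)) fun x hx => by
    by_contra hxU
    refine hout (fun x => 1 - χ x) x ?_ hx
    filter_upwards [hχ1 x ⟨hsub _ hx, hxU⟩] with y hy
    rw [hy, sub_self]
  have hsum : divergenceDefect Ω v f = divergenceDefect Ω v (fun x => χ x * f x) +
      divergenceDefect Ω v (fun x => (1 - χ x) * f x) := by
    rw [← divergenceDefect_add h hf0 hf1]
    congr 1
    ext x
    ring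
  have hint : ∫ x in frontier Ω, |f x| ∂(μHE[p - 1] : Measure (Space p)) =
      ∫ x in frontier Ω, |χ x * f x| ∂(μHE[p - 1] : Measure (Space p)) +
      ∫ x in frontier Ω, |(1 - χ x) * f x| ∂(μHE[p - 1] : Measure (Space p)) := by
    rw [← integral_add (h.integrableOn_frontier hf0.continuous).abs
      (h.integrableOn_frontier hf1.continuous).abs]
    congr 1
    ext x
    rw [abs_mul, abs_mul, abs_of_nonneg (hχ01 x).1, abs_of_nonneg (sub_nonneg.2 (hχ01 x).2)]
    ring
  rw [hsum, hint, mul_add]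
  exact (abs_add_le _ _).trans (add_le_add b0 b1)

/-- The divergence theorem for fields that vanish near the singular part of the boundary. On the
sets of a finite cover of the support the defect is at most `η ∫ |f|`, and this bound does not
depend on the cover, so that `η` can be sent to zero. -/
theorem divergenceDefect_eq_zero_of_disjoint_singularBoundary (hp : 1 ≤ p)
    (h : IsPiecewiseC1Domain Ω) (hf : PointwiseLipschitzIn Ω f) (hfc : HasCompactSupport f)
    (hfs : Disjoint (tsupport f) (singularBoundary Ω)) (v : Space p) :
    divergenceDefect Ω v f = 0 := by
  set I := ∫ x in frontier Ω, |f x| ∂(μHE[p - 1] : Measure (Space p)) with hI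
  have hI0 : 0 ≤ I := integral_nonneg fun x => abs_nonneg _
  suffices key : ∀ η > 0, |divergenceDefect Ω v f| ≤ η * I by
    rw [← abs_nonpos_iff]
    refine le_of_forall_pos_le_add fun ε hε => ?_
    have := key (ε / (I + 1)) (by positivity)
    rw [zero_add]
    refine this.trans ?_
    rw [div_mul_eq_mul_div, div_le_iff₀ (by positivity)]
    nlinarith
  intro η hη
  have hloc : ∀ x ∈ tsupport f, ∃ U, IsOpen U ∧ x ∈ U ∧ ∀ f, PointwiseLipschitzIn Ω f →
      HasCompactSupport f → tsupport f ⊆ U → |divergenceDefect Ω v f| ≤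
        η * ∫ x in frontier Ω, |f x| ∂(μHE[p - 1] : Measure (Space p)) := by
    intro x hx
    have hnn : ∀ g : Space p → ℝ,
        0 ≤ η * ∫ x in frontier Ω, |g x| ∂(μHE[p - 1] : Measure (Space p)) := fun g =>
      mul_nonneg hη.le (integral_nonneg fun x => abs_nonneg _)
    by_cases hxΩ : x ∈ Ω
    · refine ⟨Ω, h.isOpen, hxΩ, fun g hg _ hgΩ => ?_⟩
      rw [divergenceDefect_eq_zero_of_tsupport_subset h hg hgΩ, abs_zero]
      exact hnn g
    by_cases hxc : x ∈ closure Ω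
    · have hxf : x ∈ frontier Ω := by
        rw [h.isOpen.frontier_eq]; exact ⟨hxc, hxΩ⟩
      obtain ⟨ν, hν⟩ : ∃ ν, IsOutwardNormal Ω x ν := by
        by_contra hcon
        exact disjoint_left.1 hfs hx ⟨hxf, hcon⟩
      obtain ⟨U, hU, hxU, hest⟩ := exists_nhds_abs_divergenceDefect_le hp h hν v hη
      exact ⟨U, hU, hxU, fun g hg _ hgU => hest g hg hgU⟩
    · refine ⟨(closure Ω)ᶜ, isClosed_closure.isOpen_compl, hxc, fun g hg _ hgΩ => ?_⟩
      rw [divergenceDefect_eq_zero_of_disjoint hgΩ, abs_zero]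
      exact hnn g
  choose! U hUo hxU hest using hloc
  obtain ⟨s, hcov⟩ := hfc.isCompact.elim_nhds_subcover' (fun x _ => U x)
    (fun x hx => (hUo x hx).mem_nhds (hxU x hx))
  have hind : ∀ s : Finset (tsupport f), ∀ g, PointwiseLipschitzIn Ω g → HasCompactSupport g →
      tsupport g ⊆ ⋃ x ∈ s, U x → |divergenceDefect Ω v g| ≤
        η * ∫ x in frontier Ω, |g x| ∂(μHE[p - 1] : Measure (Space p)) := by
    classical
    intro s
    induction s using Finset.induction_on with
    | empty =>
      intro g hg _ hgU
      have hg0 : tsupport g ⊆ Ω := by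
        refine hgU.trans ?_
        simp
      rw [divergenceDefect_eq_zero_of_tsupport_subset h hg hg0, abs_zero]
      exact mul_nonneg hη.le (integral_nonneg fun x => abs_nonneg _)
    | insert x s _ ih =>
      intro g hg hgc hgU
      rw [Finset.set_biUnion_insert] at hgU
      exact abs_divergenceDefect_le_union h (hUo x x.2)
        (isOpen_biUnion fun (y : tsupport f) _ => hUo y y.2) (hest x x.2) ih hg hgc hgU
  exact hind s f hf hfc hcov

end Partition

/-! ### Cutting off null sets of codimension one -/

section Cutoff

variable {p : ℕ}

/-- A compact set of vanishing `d`-dimensional Hausdorff measure has finite covers by small balls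
with arbitrarily small sum of the `d`-th powers of the radii. -/
theorem exists_finite_cover_of_null {S : Set (Space p)} (hS : IsCompact S) {d : ℕ}
    (h0 : (μHE[d] : Measure (Space p)) S = 0) {ε : ℝ} (hε : 0 < ε) :
    ∃ (F : Finset ℕ) (c : ℕ → Space p) (r : ℕ → ℝ), (∀ n ∈ F, c n ∈ S ∧ 0 < r n ∧ r n ≤ ε) ∧
      S ⊆ ⋃ n ∈ F, Metric.ball (c n) (r n) ∧ ∑ n ∈ F, r n ^ d ≤ ε := by
  have hH : (μH[(d : ℝ)] : Measure (Space p)) S = 0 := by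
    rw [Measure.euclideanHausdorffMeasure_def, Measure.smul_apply, ENNReal.smul_def, smul_eq_mul,
      mul_eq_zero] at h0
    refine h0.resolve_left ?_
    exact_mod_cast Measure.addHaarScalarFactor_volume_hausdorffMeasure_ne_zero d
  have hε2 : 0 < ε / 2 := by positivity
  have hε2' : 0 < ENNReal.ofReal (ε / 2) := ENNReal.ofReal_pos.2 hε2
  rw [Measure.hausdorffMeasure_apply, ENNReal.iSup_eq_zero] at hH
  have hH1 := hH (ENNReal.ofReal (ε / 2))
  rw [ENNReal.iSup_eq_zero] at hH1
  have hH2 := (hH1 hε2').trans_lt hε2'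
  simp only [iInf_lt_iff] at hH2
  obtain ⟨t, hcov, hdiam, hsum⟩ := hH2
  set D : ℕ → ℝ := fun n => (Metric.ediam (t n)).toReal with hD
  have hfinD : ∀ n, Metric.ediam (t n) ≠ ⊤ := fun n => ((hdiam n).trans_lt ENNReal.ofReal_lt_top).ne
  have hDle : ∀ n, D n ≤ ε / 2 := fun n => ENNReal.toReal_le_of_le_ofReal hε2.le (hdiam n)
  -- radii slightly larger than the diameters
  have hr : ∀ n, ∃ r, D n < r ∧ r ≤ ε ∧ r ^ d < D n ^ d + ε / 4 * (1 / 2) ^ n := by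
    intro n
    have h1 : ∀ᶠ r in 𝓝 (D n), r ^ d < D n ^ d + ε / 4 * (1 / 2) ^ n :=
      (continuous_pow d).tendsto (D n) |>.eventually_lt_const (by
        have : 0 < ε / 4 * (1 / 2) ^ n := by positivity
        linarith)
    have h2 : ∀ᶠ r in 𝓝 (D n), r < ε := eventually_lt_nhds (by linarith [hDle n])
    obtain ⟨r, ⟨h1, h2⟩, h3⟩ := (((h1.and h2).filter_mono nhdsWithin_le_nhds).and
      (self_mem_nhdsWithin (a := D n) (s := Ioi (D n)))).exists
    exact ⟨r, h3, h2.le, h1⟩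
  choose r hDr hrε hrd using hr
  have hc : ∀ n, ∃ c, (t n ∩ S).Nonempty → c ∈ t n ∩ S := fun n => by
    by_cases h : (t n ∩ S).Nonempty
    · exact ⟨h.some, fun _ => h.some_mem⟩
    · exact ⟨0, fun h' => absurd h' h⟩
  choose c hc using hc
  have hcovS : S ⊆ ⋃ n ∈ {n | (t n ∩ S).Nonempty}, Metric.ball (c n) (r n) := by
    intro x hx
    obtain ⟨n, hn⟩ := mem_iUnion.1 (hcov hx)
    have hne : (t n ∩ S).Nonempty := ⟨x, hn, hx⟩
    refine mem_biUnion (show n ∈ {n | (t n ∩ S).Nonempty} from hne) ?_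
    rw [Metric.mem_ball, dist_edist]
    refine lt_of_le_of_lt ?_ (hDr n)
    exact ENNReal.toReal_mono (hfinD n) (Metric.edist_le_ediam_of_mem hn (hc n hne).1)
  obtain ⟨b, hbs, hbf, hbc⟩ := hS.elim_finite_subcover_image
    (fun n _ => Metric.isOpen_ball) hcovS
  have hD0 : ∀ n, 0 ≤ D n := fun n => ENNReal.toReal_nonneg
  refine ⟨hbf.toFinset, c, r, fun n hn => ?_, ?_, ?_⟩
  · have hne := hbs (hbf.mem_toFinset.1 hn)
    exact ⟨(hc n hne).2, (hD0 n).trans_lt (hDr n), hrε n⟩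
  · simpa using hbc
  · have h1 : ∑ n ∈ hbf.toFinset, D n ^ d ≤ ε / 2 := by
      have h2 : ENNReal.ofReal (∑ n ∈ hbf.toFinset, D n ^ d) ≤ ENNReal.ofReal (ε / 2) := by
        rw [ENNReal.ofReal_sum_of_nonneg fun n _ => pow_nonneg (hD0 n) d]
        refine le_trans (Finset.sum_le_sum fun n hn => ?_)
          ((ENNReal.sum_le_tsum hbf.toFinset).trans hsum.le)
        have hne : (t n).Nonempty := (hbs (hbf.mem_toFinset.1 hn) : (t n ∩ S).Nonempty).mono
          inter_subset_left
        rw [ciSup_pos hne, ENNReal.ofReal_pow (hD0 n), ENNReal.ofReal_toReal (hfinD n),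
          ENNReal.rpow_natCast]
      exact (ENNReal.ofReal_le_ofReal_iff hε2.le).1 h2
    have h2 : ∑ n ∈ hbf.toFinset, ε / 4 * (1 / 2 : ℝ) ^ n ≤ ε / 2 := by
      rw [← Finset.mul_sum]
      have := summable_geometric_two.sum_le_tsum hbf.toFinset fun n _ => by positivity
      rw [tsum_geometric_two] at this
      nlinarith
    calc _ ≤ ∑ n ∈ hbf.toFinset, (D n ^ d + ε / 4 * (1 / 2) ^ n) :=
          Finset.sum_le_sum fun n _ => (hrd n).le
      _ ≤ ε := by rw [Finset.sum_add_distrib]; linarith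

/-- A set of vanishing `(p - 1)`-dimensional measure has vanishing capacity: there are cutoff
functions that vanish near it, are `1` away from it, and have small gradient in `L¹`. -/
theorem exists_cutoff (hp : 1 ≤ p) {S : Set (Space p)} (hS : IsCompact S)
    (h0 : (μHE[p - 1] : Measure (Space p)) S = 0) {ε : ℝ} (hε : 0 < ε) :
    ∃ (η : Space p → ℝ) (L : NNReal) (g : Space p → ℝ), LipschitzWith L η ∧
      (∀ x, 0 ≤ η x ∧ η x ≤ 1) ∧ (∀ x ∈ S, ∀ᶠ y in 𝓝 x, η y = 0) ∧
      (∀ x, (∀ s ∈ S, ε < dist x s) → η x = 1) ∧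
      Integrable g ∧ ∫ x, g x ≤ ε ∧ ∀ x v, |lineDeriv ℝ η x v| ≤ ‖v‖ * g x := by
  set ω : ℝ := (volume : Measure (Space p)).real (Metric.ball 0 1) with hω
  have hω0 : 0 ≤ ω := measureReal_nonneg
  -- `2 ^ p * ω` is the volume of a ball of radius `2`
  set ε' : ℝ := min (ε / 2) (ε / (2 ^ p * (ω + 1))) with hε'
  have hε'0 : 0 < ε' := by positivity
  obtain ⟨F, c, r, hF, hcov, hsum⟩ := exists_finite_cover_of_null hS h0 hε'0
  -- `θ n` is `1` on the `n`-th ball and `0` outside the ball of twice the radius; the volume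
  -- `2 ^ p * ω * r ^ p` of the latter times the slope `1 / r` is a multiple of `r ^ (p - 1)`
  set θ : ℕ → Space p → ℝ := fun n x => max 0 (min 1 (2 - (r n)⁻¹ * dist x (c n))) with hθ
  have hθ0 : ∀ n x, 0 ≤ θ n x := fun n x => le_max_left _ _
  have hθlip : ∀ n ∈ F, ∀ x y, |θ n y - θ n x| ≤ (r n)⁻¹ * ‖y - x‖ := by
    intro n hn x y
    have hrn : 0 ≤ (r n)⁻¹ := inv_nonneg.2 (hF n hn).2.1.le
    have h1 : |θ n y - θ n x| ≤
        |(2 - (r n)⁻¹ * dist y (c n)) - (2 - (r n)⁻¹ * dist x (c n))| := by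
      refine (abs_max_sub_max_le_max 0 _ 0 _).trans ?_
      rw [sub_self, abs_zero, max_eq_right (abs_nonneg _)]
      refine (abs_min_sub_min_le_max 1 _ 1 _).trans ?_
      rw [sub_self, abs_zero, max_eq_right (abs_nonneg _)]
    refine h1.trans ?_
    have h2 : (2 - (r n)⁻¹ * dist y (c n)) - (2 - (r n)⁻¹ * dist x (c n)) =
        (r n)⁻¹ * (dist x (c n) - dist y (c n)) := by ring
    rw [h2, abs_mul, abs_of_nonneg hrn, ← dist_eq_norm, dist_comm y x]
    exact mul_le_mul_of_nonneg_left (abs_dist_sub_le x y (c n)) hrn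
  have hθout : ∀ n ∈ F, ∀ x, x ∉ Metric.closedBall (c n) (2 * r n) → θ n x = 0 := by
    intro n hn x hx
    rw [Metric.mem_closedBall, not_le] at hx
    have hrn := (hF n hn).2.1
    have : 2 ≤ (r n)⁻¹ * dist x (c n) := by
      rw [inv_mul_eq_div, le_div_iff₀ hrn]; exact hx.le
    exact max_eq_left ((min_le_right _ _).trans (by linarith))
  set η : Space p → ℝ := fun x => max 0 (1 - ∑ n ∈ F, θ n x) with hη
  have hηdiff : ∀ x y, |η y - η x| ≤ ∑ n ∈ F, |θ n y - θ n x| := by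
    intro x y
    refine (abs_max_sub_max_le_max 0 _ 0 _).trans ?_
    rw [sub_self, abs_zero, max_eq_right (abs_nonneg _)]
    have : (1 - ∑ n ∈ F, θ n y) - (1 - ∑ n ∈ F, θ n x) = -∑ n ∈ F, (θ n y - θ n x) := by
      rw [Finset.sum_sub_distrib]; ring
    rw [this, abs_neg]
    exact Finset.abs_sum_le_sum_abs _ _
  set g : Space p → ℝ := fun x =>
    ∑ n ∈ F, (Metric.closedBall (c n) (2 * r n)).indicator (fun _ => (r n)⁻¹) x with hg
  have hgint : ∀ n ∈ F, Integrable
      ((Metric.closedBall (c n) (2 * r n)).indicator fun _ => (r n)⁻¹) := fun n _ =>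
    (integrable_indicator_iff Metric.isClosed_closedBall.measurableSet).2
      (integrableOn_const (Metric.isBounded_closedBall.measure_lt_top.ne))
  have hC : (0 : ℝ) ≤ ∑ n ∈ F, (r n)⁻¹ :=
    Finset.sum_nonneg fun n hn => inv_nonneg.2 (hF n hn).2.1.le
  refine ⟨η, (∑ n ∈ F, (r n)⁻¹).toNNReal, g, ?_, fun x => ⟨le_max_left _ _, ?_⟩, ?_, ?_, ?_, ?_, ?_⟩
  · apply LipschitzWith.of_dist_le_mul
    intro x y
    rw [Real.coe_toNNReal _ hC, dist_comm, dist_comm x, Real.dist_eq, dist_eq_norm, Finset.sum_mul]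
    exact (hηdiff x y).trans (Finset.sum_le_sum fun n hn => hθlip n hn x y)
  · refine max_le zero_le_one ?_
    have : 0 ≤ ∑ n ∈ F, θ n x := Finset.sum_nonneg fun n _ => hθ0 n x
    linarith
  · intro x hx
    obtain ⟨n, hn, hxn⟩ := mem_iUnion₂.1 (hcov hx)
    filter_upwards [Metric.isOpen_ball.mem_nhds hxn] with y hy
    have hrn := (hF n hn).2.1
    have h1 : 1 ≤ θ n y := by
      have : (r n)⁻¹ * dist y (c n) ≤ 1 := by
        rw [inv_mul_eq_div, div_le_one hrn]; exact (Metric.mem_ball.1 hy).le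
      exact le_max_of_le_right (le_min le_rfl (by linarith))
    have h2 : θ n y ≤ ∑ n ∈ F, θ n y :=
      Finset.single_le_sum (f := fun n => θ n y) (fun n _ => hθ0 n y) hn
    exact max_eq_left (by linarith)
  · intro x hx
    have : ∑ n ∈ F, θ n x = 0 := by
      refine Finset.sum_eq_zero fun n hn => hθout n hn x ?_
      rw [Metric.mem_closedBall, not_le]
      have h1 := (hF n hn).2.2.trans (min_le_left _ _)
      have h2 := hx _ (hF n hn).1
      linarith
    simp [hη, this]
  · exact integrable_finsetSum F hgint
  · rw [integral_finsetSum F hgint]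
    have hvol : ∀ n ∈ F, ∫ x, (Metric.closedBall (c n) (2 * r n)).indicator (fun _ => (r n)⁻¹) x =
        2 ^ p * ω * r n ^ (p - 1) := by
      intro n hn
      have hrn := (hF n hn).2.1
      rw [integral_indicator Metric.isClosed_closedBall.measurableSet, setIntegral_const,
        Measure.real, Measure.addHaar_closedBall _ _ (by positivity), ENNReal.toReal_mul,
        ENNReal.toReal_ofReal (by positivity), finrank_euclideanSpace_fin, smul_eq_mul, hω,
        Measure.real, mul_pow]
      obtain ⟨q, rfl⟩ : ∃ q, p = q + 1 := ⟨p - 1, by omega⟩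
      rw [Nat.add_sub_cancel, pow_succ (r n)]
      field_simp
    rw [Finset.sum_congr rfl hvol, ← Finset.mul_sum]
    have h1 : ∑ n ∈ F, r n ^ (p - 1) ≤ ε / (2 ^ p * (ω + 1)) := hsum.trans (min_le_right _ _)
    calc 2 ^ p * ω * ∑ n ∈ F, r n ^ (p - 1) ≤ 2 ^ p * (ω + 1) * (ε / (2 ^ p * (ω + 1))) :=
          mul_le_mul (mul_le_mul_of_nonneg_left (by linarith) (by positivity)) h1
            (Finset.sum_nonneg fun n hn => pow_nonneg (hF n hn).2.1.le _) (by positivity)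
      _ = ε := by field_simp
  · intro x v
    have hg0 : 0 ≤ g x := Finset.sum_nonneg fun n hn =>
      indicator_nonneg (fun _ _ => inv_nonneg.2 (hF n hn).2.1.le) x
    rw [mul_comm]
    refine abs_lineDeriv_le hg0 ?_ v
    have hev : ∀ n ∈ F, ∀ᶠ y in 𝓝 x, |θ n y - θ n x| ≤
        (Metric.closedBall (c n) (2 * r n)).indicator (fun _ => (r n)⁻¹) x * ‖y - x‖ := by
      intro n hn
      by_cases hx : x ∈ Metric.closedBall (c n) (2 * r n)
      · rw [indicator_of_mem hx]
        exact Eventually.of_forall fun y => hθlip n hn x y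
      · rw [indicator_of_notMem hx]
        filter_upwards [Metric.isClosed_closedBall.isOpen_compl.mem_nhds hx] with y hy
        rw [hθout n hn y hy, hθout n hn x hx]
        simp
    filter_upwards [(Finset.eventually_all F).2 hev] with y hy
    rw [hg, Finset.sum_mul]
    exact (hηdiff x y).trans (Finset.sum_le_sum hy)

end Cutoff

/-! ### The divergence theorem -/

section DivergenceTheorem

variable {p : ℕ} {Ω : Set (Space p)} {f : Space p → ℝ}

theorem IsPiecewiseC1Domain.volume_singularBoundary (h : IsPiecewiseC1Domain Ω) (hp : 1 ≤ p) :
    volume (singularBoundary Ω) = 0 := by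
  have hv : (volume : Measure (Space p)) = μHE[p] :=
    (EuclideanSpace.euclideanHausdorffMeasure_eq_volume p).symm
  rw [hv]
  refine (Measure.euclideanHausdorffMeasure_zero_or_top (by omega : p - 1 < p) _).resolve_right ?_
  rw [h.singular_null]
  exact ENNReal.zero_ne_top

/-- The divergence theorem for `f v`, `v` a constant vector: the singular part of the boundary is
cut off by functions whose gradients tend to zero in `L¹`. -/
theorem divergenceDefect_eq_zero (hp : 1 ≤ p) (h : IsPiecewiseC1Domain Ω)
    (hf : PointwiseLipschitzIn Ω f) (hfc : HasCompactSupport f) (v : Space p) :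
    divergenceDefect Ω v f = 0 := by
  set S := singularBoundary Ω with hS
  have hSc : IsCompact S := h.isBounded.isCompact_closure.of_isClosed_subset
    h.isClosed_singularBoundary fun x hx => frontier_subset_closure hx.1
  set e : ℕ → ℝ := fun n => 1 / ((n : ℝ) + 1) with he
  have he0 : ∀ n, 0 < e n := fun n => Nat.one_div_pos_of_nat
  have helim : Tendsto e atTop (𝓝 0) := tendsto_one_div_add_atTop_nhds_zero_nat
  choose η L g hlip h01 hzero hone hgi hgs hgb using fun n =>
    exists_cutoff hp hSc h.singular_null (he0 n)
  have hlim : ∀ x ∉ S, Tendsto (fun n => η n x) atTop (𝓝 1) := by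
    intro x hx
    obtain ⟨r, hr, hball⟩ := Metric.isOpen_iff.1 h.isClosed_singularBoundary.isOpen_compl x hx
    refine tendsto_const_nhds.congr' ?_
    filter_upwards [helim.eventually_lt_const hr] with n hn
    refine (hone n x fun s hs => ?_).symm
    by_contra hcon
    refine hball (?_ : s ∈ Metric.ball x r) hs
    rw [Metric.mem_ball, dist_comm]
    linarith
  have hη1 : ∀ n x, |η n x| ≤ 1 := fun n x => abs_le.2 ⟨by linarith [(h01 n x).1], (h01 n x).2⟩
  have hdi := hf.integrableOn_lineDeriv h.isOpen h.isBounded v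
  have hni := h.integrableOn_mul_normal hf.continuous v
  obtain ⟨A, hA⟩ := h.isBounded.isCompact_closure.exists_bound_of_continuousOn
    hf.continuous.continuousOn
  have hA0 : ∀ x ∈ Ω, |f x| ≤ |A| := fun x hx => (hA x (subset_closure hx)).trans (le_abs_self A)
  -- the identity for the cut-off functions
  have hηmeas : ∀ n, Measurable fun x => lineDeriv ℝ (η n) x v := fun n =>
    measurable_lineDeriv (hlip n).continuous
  have herr : ∀ n, IntegrableOn (fun x => f x * lineDeriv ℝ (η n) x v) Ω := fun n => by
    refine Integrable.mono (((hgi n).const_mul (|A| * ‖v‖)).integrableOn)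
      (hf.continuous.aestronglyMeasurable.mul (hηmeas n).aestronglyMeasurable) ?_
    filter_upwards [ae_restrict_mem h.isOpen.measurableSet] with x hx
    rw [norm_mul, mul_assoc, norm_mul |A|, Real.norm_eq_abs, Real.norm_eq_abs, Real.norm_eq_abs,
      Real.norm_eq_abs, abs_abs]
    exact mul_le_mul (hA0 x hx) ((hgb n x v).trans (le_abs_self _)) (abs_nonneg _) (abs_nonneg _)
  have hid : ∀ n, (∫ x in Ω, η n x * lineDeriv ℝ f x v) + ∫ x in Ω, f x * lineDeriv ℝ (η n) x v =
      ∫ x in frontier Ω, η n x * (f x * inner ℝ (outwardNormal Ω x) v)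
        ∂(μHE[p - 1] : Measure (Space p)) := by
    intro n
    have hfn := hf.lipschitz_mul h.isBounded (hlip n)
    have hd := divergenceDefect_eq_zero_of_disjoint_singularBoundary hp h hfn hfc.mul_left
      (disjoint_left.2 fun x hx hxS => by
        refine (notMem_tsupport_iff_eventuallyEq.2 ?_ : x ∉ tsupport _) hx
        filter_upwards [hzero n x hxS] with y hy
        simp [hy]) v
    rw [divergenceDefect, sub_eq_zero] at hd
    simp only [mul_assoc] at hd
    rw [← hd, ← integral_add _ (herr n)]
    · refine setIntegral_congr_ae h.isOpen.measurableSet ?_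
      filter_upwards [hf.ae_differentiableAt, (hlip n).ae_differentiableAt] with x h1 h2 hx
      rw [(h1 hx).lineDeriv_eq_fderiv, h2.lineDeriv_eq_fderiv,
        (h2.fun_mul (h1 hx)).lineDeriv_eq_fderiv, fderiv_fun_mul h2 (h1 hx)]
      rfl
    · exact hdi.bdd_mul (c := 1) (hlip n).continuous.aestronglyMeasurable
        (ae_of_all _ fun x => hη1 n x)
  have l1 : Tendsto (fun n => ∫ x in Ω, η n x * lineDeriv ℝ f x v) atTop
      (𝓝 (∫ x in Ω, lineDeriv ℝ f x v)) := by
    refine tendsto_integral_of_dominated_convergence (fun x => ‖lineDeriv ℝ f x v‖)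
      (fun n => (hlip n).continuous.aestronglyMeasurable.mul hdi.aestronglyMeasurable) hdi.norm
      (fun n => ae_of_all _ fun x => ?_) ?_
    · rw [norm_mul]
      exact mul_le_of_le_one_left (norm_nonneg _) (hη1 n x)
    · have : ∀ᵐ x ∂(volume : Measure (Space p)).restrict Ω, x ∉ S :=
        ae_restrict_of_ae (measure_eq_zero_iff_ae_notMem.1 (h.volume_singularBoundary hp))
      filter_upwards [this] with x hx
      simpa using (hlim x hx).mul_const (lineDeriv ℝ f x v)
  have l2 : Tendsto (fun n => ∫ x in Ω, f x * lineDeriv ℝ (η n) x v) atTop (𝓝 0) := by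
    refine squeeze_zero_norm (a := fun n => |A| * ‖v‖ * e n) (fun n => ?_) (by
      simpa using helim.const_mul (|A| * ‖v‖))
    refine (norm_integral_le_integral_norm _).trans ?_
    have hg0 : ∀ x, 0 ≤ |A| * (‖v‖ * g n x) := fun x =>
      mul_nonneg (abs_nonneg _) ((abs_nonneg _).trans (hgb n x v))
    have hgi' : Integrable fun x => |A| * (‖v‖ * g n x) := ((hgi n).const_mul _).const_mul _
    calc ∫ x in Ω, ‖f x * lineDeriv ℝ (η n) x v‖ ≤ ∫ x in Ω, |A| * (‖v‖ * g n x) := by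
          refine setIntegral_mono_on (herr n).norm hgi'.integrableOn h.isOpen.measurableSet
            fun x hx => ?_
          rw [norm_mul]
          exact mul_le_mul (hA0 x hx) (hgb n x v) (abs_nonneg _) (abs_nonneg _)
      _ ≤ ∫ x, |A| * (‖v‖ * g n x) := setIntegral_le_integral hgi' (ae_of_all _ hg0)
      _ = |A| * ‖v‖ * ∫ x, g n x := by
          rw [integral_const_mul, integral_const_mul, mul_assoc]
      _ ≤ _ := mul_le_mul_of_nonneg_left (hgs n) (by positivity)
  have l3 : Tendsto (fun n => ∫ x in frontier Ω, η n x * (f x * inner ℝ (outwardNormal Ω x) v)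
      ∂(μHE[p - 1] : Measure (Space p))) atTop
      (𝓝 (∫ x in frontier Ω, f x * inner ℝ (outwardNormal Ω x) v
        ∂(μHE[p - 1] : Measure (Space p)))) := by
    refine tendsto_integral_of_dominated_convergence
      (fun x => ‖f x * inner ℝ (outwardNormal Ω x) v‖)
      (fun n => (hlip n).continuous.aestronglyMeasurable.mul hni.aestronglyMeasurable) hni.norm
      (fun n => ae_of_all _ fun x => ?_) ?_
    · rw [norm_mul]
      exact mul_le_of_le_one_left (norm_nonneg _) (hη1 n x)
    · have : ∀ᵐ x ∂(μHE[p - 1] : Measure (Space p)).restrict (frontier Ω), x ∉ S :=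
        ae_restrict_of_ae (measure_eq_zero_iff_ae_notMem.1 h.singular_null)
      filter_upwards [this] with x hx
      simpa using (hlim x hx).mul_const (f x * inner ℝ (outwardNormal Ω x) v)
  have l4 := l1.add l2
  simp only [hid, add_zero] at l4
  rw [divergenceDefect, sub_eq_zero]
  exact tendsto_nhds_unique l4 l3

/-- Functions on the closure of `Ω` extend to compactly supported functions on the whole space. -/
theorem exists_pointwiseLipschitzIn_extension (hΩ : IsOpen Ω) (hb : Bornology.IsBounded Ω)
    (hc : ContinuousOn f (closure Ω))
    (hl : ∃ C, ∀ x ∈ Ω, ∀ᶠ y in 𝓝 x, |f y - f x| ≤ C * ‖y - x‖)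
    (hd : ∀ᵐ x ∂(volume : Measure (Space p)), x ∈ Ω → DifferentiableAt ℝ f x) :
    ∃ g, PointwiseLipschitzIn Ω g ∧ HasCompactSupport g ∧ EqOn g f (closure Ω) := by
  obtain ⟨G, hG⟩ := ContinuousMap.exists_restrict_eq isClosed_closure
    ⟨(closure Ω).domRestrict f, continuousOn_iff_continuous_domRestrict.1 hc⟩
  have hGf : ∀ x ∈ closure Ω, G x = f x := fun x hx =>
    congrArg (fun k : C(closure Ω, ℝ) => k ⟨x, hx⟩) hG
  have hone : (0 : ℝ) < 1 := one_pos
  set χ : Space p → ℝ := fun x => thickenedIndicator hone (closure Ω) x with hχ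
  have hχc : Continuous χ := NNReal.continuous_coe.comp (thickenedIndicator hone (closure Ω)).continuous
  have heq : EqOn (fun x => χ x * G x) f (closure Ω) := fun x hx => by
    simp only [hχ, thickenedIndicator_one hone _ hx, NNReal.coe_one, one_mul, hGf x hx]
  have hev : ∀ x ∈ Ω, (fun x => χ x * G x) =ᶠ[𝓝 x] f := fun x hx => by
    filter_upwards [hΩ.mem_nhds hx] with y hy using heq (subset_closure hy)
  refine ⟨fun x => χ x * G x, ⟨hχc.mul G.continuous, ?_, ?_⟩, ?_, heq⟩
  · obtain ⟨C, hC⟩ := hl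
    refine ⟨C, fun x hx => ?_⟩
    filter_upwards [hC x hx, hev x hx] with y hy hy'
    have hx' : χ x * G x = f x := (hev x hx).self_of_nhds
    rwa [hy', hx']
  · filter_upwards [hd] with x h hx
    exact (h hx).congr_of_eventuallyEq (hev x hx)
  · refine HasCompactSupport.of_support_subset_isCompact
      (hb.isCompact_closure.cthickening (r := 1)) fun x hx => ?_
    by_contra hcon
    refine left_ne_zero_of_mul hx ?_
    simp only [hχ]
    rw [thickenedIndicator_zero hone _ fun h => hcon (Metric.thickening_subset_cthickening _ _ h)]
    rfl

/-- The divergence theorem on a domain with piecewise smooth boundary, for fields that are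
continuous up to the boundary, differentiable almost everywhere and have bounded pointwise
Lipschitz constant in the interior. -/
theorem integral_divergence_eq (hp : 1 ≤ p) (h : IsPiecewiseC1Domain Ω) {V : Space p → Space p}
    (hc : ContinuousOn V (closure Ω))
    (hl : ∃ C, ∀ x ∈ Ω, ∀ᶠ y in 𝓝 x, ‖V y - V x‖ ≤ C * ‖y - x‖)
    (hd : ∀ᵐ x ∂(volume : Measure (Space p)), x ∈ Ω → DifferentiableAt ℝ V x) :
    IntegrableOn (divergence V) Ω ∧
    ∫ x in Ω, divergence V x =
      ∫ x in frontier Ω, inner ℝ (outwardNormal Ω x) (V x) ∂(μHE[p - 1] : Measure (Space p)) := by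
  have hcomp : ∀ i : Fin p, ∃ g, PointwiseLipschitzIn Ω g ∧ HasCompactSupport g ∧
      EqOn g (fun x => V x i) (closure Ω) := by
    intro i
    refine exists_pointwiseLipschitzIn_extension h.isOpen h.isBounded
      ((EuclideanSpace.proj (𝕜 := ℝ) i).continuous.comp_continuousOn hc) ?_ ?_
    · obtain ⟨C, hC⟩ := hl
      refine ⟨C, fun x hx => ?_⟩
      filter_upwards [hC x hx] with y hy
      exact (PiLp.norm_apply_le (V y - V x) i).trans hy
    · filter_upwards [hd] with x h hx
      exact (EuclideanSpace.proj (𝕜 := ℝ) i).differentiableAt.comp x (h hx)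
  choose g hg hgc hgV using hcomp
  have hdiv : ∀ᵐ x ∂(volume : Measure (Space p)), x ∈ Ω →
      ∑ i, lineDeriv ℝ (g i) x (EuclideanSpace.single i 1) = divergence V x := by
    filter_upwards [hd] with x hx hxΩ
    rw [divergence]
    refine Finset.sum_congr rfl fun i _ => ?_
    have hev : g i =ᶠ[𝓝 x] fun x => V x i := by
      filter_upwards [h.isOpen.mem_nhds hxΩ] with y hy using hgV i (subset_closure hy)
    rw [hev.lineDeriv_eq]
    have hfd : HasFDerivAt (fun x => V x i)
        ((EuclideanSpace.proj (𝕜 := ℝ) i).comp (fderiv ℝ V x)) x :=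
      (EuclideanSpace.proj (𝕜 := ℝ) i).hasFDerivAt.comp x (hx hxΩ).hasFDerivAt
    rw [(hfd.hasLineDerivAt _).lineDeriv]
    rfl
  have hint : ∀ i, IntegrableOn (fun x => lineDeriv ℝ (g i) x (EuclideanSpace.single i 1)) Ω :=
    fun i => (hg i).integrableOn_lineDeriv h.isOpen h.isBounded _
  constructor
  · refine (integrable_finsetSum Finset.univ fun i _ => hint i).congr ?_
    exact (ae_restrict_iff' h.isOpen.measurableSet).2 hdiv
  rw [← setIntegral_congr_ae h.isOpen.measurableSet hdiv,
    integral_finsetSum _ fun i _ => hint i]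
  have hbd : ∀ i, ∫ x in Ω, lineDeriv ℝ (g i) x (EuclideanSpace.single i 1) =
      ∫ x in frontier Ω, g i x * inner ℝ (outwardNormal Ω x) (EuclideanSpace.single i 1)
        ∂(μHE[p - 1] : Measure (Space p)) := fun i =>
    sub_eq_zero.1 (divergenceDefect_eq_zero hp h (hg i) (hgc i) _)
  simp only [hbd]
  rw [← integral_finsetSum _ fun i _ => h.integrableOn_mul_normal (hg i).continuous _]
  refine setIntegral_congr_fun isClosed_frontier.measurableSet fun x hx => ?_
  simp only [PiLp.inner_apply (x := outwardNormal Ω x) (y := V x)]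
  refine Finset.sum_congr rfl fun i _ => ?_
  rw [hgV i (frontier_subset_closure hx), EuclideanSpace.inner_single_right]
  simp

end DivergenceTheorem

/-! ### Position and velocity in the reference coordinates -/

/-- A linear map with nonzero determinant is bounded below, and so are nearby maps. -/
theorem exists_eventually_le_norm_apply {p : ℕ} {J : Space p → Space p →L[ℝ] Space p}
    {K : Set (Space p)} {y₀ : Space p} (hJ : ContinuousWithinAt J K y₀) (hdet : (J y₀).det ≠ 0) :
    ∃ κ : ℝ, 0 < κ ∧ ∀ᶠ y in 𝓝[K] y₀, ∀ v, κ * ‖v‖ ≤ ‖J y v‖ := by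
  set e := (J y₀).toContinuousLinearEquivOfDetNeZero hdet with he
  set c : ℝ := ‖(e.symm : Space p →L[ℝ] Space p)‖ + 1 with hc
  have hc0 : 0 < c := by positivity
  have hbelow : ∀ v, ‖v‖ ≤ c * ‖J y₀ v‖ := fun v => by
    have h1 := (e.symm : Space p →L[ℝ] Space p).le_opNorm (J y₀ v)
    have h2 : e.symm (J y₀ v) = v := e.symm_apply_apply v
    rw [ContinuousLinearEquiv.coe_coe, h2] at h1
    nlinarith [norm_nonneg (J y₀ v)]
  have hκ : 0 < 1 / (2 * c) := by positivity
  refine ⟨1 / (2 * c), hκ, ?_⟩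
  filter_upwards [hJ (Metric.ball_mem_nhds _ hκ)] with y hy v
  have h2 : ‖(J y - J y₀) v‖ ≤ 1 / (2 * c) * ‖v‖ := by
    refine (ContinuousLinearMap.le_opNorm _ _).trans ?_
    rw [← dist_eq_norm]
    exact mul_le_mul_of_nonneg_right (le_of_lt hy) (norm_nonneg v)
  have h3 := norm_sub_norm_le (J y₀ v) (J y₀ v - J y v)
  rw [sub_sub_cancel, norm_sub_rev (J y₀ v)] at h3
  have h4 : 2 * (1 / (2 * c) * ‖v‖) ≤ ‖J y₀ v‖ := by
    have : 2 * (1 / (2 * c) * ‖v‖) = ‖v‖ / c := by field_simp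
    rw [this, div_le_iff₀ hc0, mul_comm]
    exact hbelow v
  rw [sub_apply] at h2
  linarith

theorem eventually_norm_lt_of_continuousWithinAt {E F : Type*} [TopologicalSpace E]
    [NormedAddCommGroup F] {f : E → F} {s : Set E} {x : E} (h : ContinuousWithinAt f s x) :
    ∀ᶠ y in 𝓝[s] x, ‖f y‖ < ‖f x‖ + 1 :=
  h.norm.tendsto.eventually_lt_const (lt_add_one _)

namespace MovingDomain

variable {p : ℕ} (M : MovingDomain p)

/-- The coordinate velocity as a function of the reference coordinates. -/
noncomputable def refVelocity (t : ℝ) (y : Space p) : Space p :=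
  derivWithin (fun s => M.X s y) (Icc M.t₀ M.T) t

/-- On the closure of a block both the position and the velocity are differentiable functions of
the reference coordinates, with continuous derivatives. -/
theorem exists_hasFDerivWithinAt {k : Fin M.N} {t : ℝ} (ht : t ∈ Icc M.t₀ M.T) {y₀ : Space p}
    (hy₀ : y₀ ∈ closure (M.block k)) :
    ∃ J W : Space p → Space p →L[ℝ] Space p,
      ContinuousWithinAt J (closure (M.block k)) y₀ ∧
      ContinuousWithinAt W (closure (M.block k)) y₀ ∧
      ∀ᶠ y in 𝓝[closure (M.block k)] y₀,
        HasFDerivWithinAt (M.X t) (J y) (closure (M.block k)) y ∧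
        HasFDerivWithinAt (M.refVelocity t) (W y) (closure (M.block k)) y := by
  set K := closure (M.block k) with hK
  set Q : Set (ℝ × Space p) := Icc M.t₀ M.T ×ˢ K with hQ
  have hq₀ : (t, y₀) ∈ Q := ⟨ht, hy₀⟩
  have h2 : ContDiffWithinAt ℝ (1 + 1) (Function.uncurry M.X) Q (t, y₀) := by
    have := M.contDiffOn_X k (t, y₀) hq₀
    rwa [one_add_one_eq_two]
  obtain ⟨u, hu, -, -, f', hf', hf'1⟩ :=
    (contDiffWithinAt_succ_iff_hasFDerivWithinAt' (by simp)).1 h2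
  rw [← zero_add (1 : WithTop ℕ∞)] at hf'1
  obtain ⟨w, hw, -, -, f'', hf'', hf''0⟩ :=
    (contDiffWithinAt_succ_iff_hasFDerivWithinAt' (by simp)).1 hf'1
  rw [insert_eq_of_mem hq₀] at hu hw
  have hmaps : MapsTo (fun y : Space p => (t, y)) K Q := fun y hy => ⟨ht, hy⟩
  have hline : ∀ y, HasFDerivWithinAt (fun y : Space p => (t, y)) (.inr ℝ ℝ (Space p)) K y :=
    fun y => (hasFDerivAt_prodMk_right t y).hasFDerivWithinAt
  have htend : Tendsto (fun y : Space p => (t, y)) (𝓝[K] y₀) (𝓝[Q] (t, y₀)) :=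
    (hline y₀).continuousWithinAt.tendsto_nhdsWithin hmaps
  -- the velocity is the total derivative of the motion, evaluated at the time direction
  set ev : (ℝ × Space p →L[ℝ] Space p) →L[ℝ] Space p :=
    ContinuousLinearMap.apply ℝ (Space p) ((1, 0) : ℝ × Space p) with hev
  have hvel : ∀ y ∈ K, (t, y) ∈ u → M.refVelocity t y = ev (f' (t, y)) := by
    intro y hyK hyu
    have h1 : HasFDerivWithinAt (fun s : ℝ => (s, y)) (.inl ℝ ℝ (Space p)) (Icc M.t₀ M.T) t :=
      (hasFDerivAt_prodMk_left t y).hasFDerivWithinAt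
    have hmaps' : MapsTo (fun s : ℝ => (s, y)) (Icc M.t₀ M.T) Q := fun s hs => ⟨hs, hyK⟩
    have h3 := ((hf' _ hyu).comp t h1 hmaps').hasDerivWithinAt
    exact h3.derivWithin (uniqueDiffOn_Icc M.t₀_lt_T t ht)
  refine ⟨fun y => (f' (t, y)).comp (.inr ℝ ℝ (Space p)),
    fun y => (ev.comp (f'' (t, y))).comp (.inr ℝ ℝ (Space p)), ?_, ?_, ?_⟩
  · have h1 : ContinuousWithinAt (fun y => f' (t, y)) K y₀ :=
      hf'1.continuousWithinAt.tendsto.comp htend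
    exact h1.clm_comp continuousWithinAt_const
  · have h1 : ContinuousWithinAt (fun y => f'' (t, y)) K y₀ :=
      hf''0.continuousWithinAt.tendsto.comp htend
    exact (continuousWithinAt_const.clm_comp h1).clm_comp continuousWithinAt_const
  · filter_upwards [htend.eventually hw, self_mem_nhdsWithin,
      eventually_eventually_nhdsWithin.2 (htend.eventually hu)] with y hyw hyK hyu
    have hyu' : (t, y) ∈ u := hyu.self_of_nhdsWithin hyK
    refine ⟨(hf' _ hyu').comp y (hline y) hmaps, ?_⟩
    have h1 : HasFDerivWithinAt (fun y => ev (f' (t, y)))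
        ((ev.comp (f'' (t, y))).comp (.inr ℝ ℝ (Space p))) K y :=
      ev.hasFDerivAt.comp_hasFDerivWithinAt y ((hf'' _ hyw).comp y (hline y) hmaps)
    refine h1.congr_of_eventuallyEq ?_ (hvel y hyK hyu')
    filter_upwards [hyu, self_mem_nhdsWithin] with y' h h' using hvel y' h' h

/-- The Jacobian determinant extends to the closure of a block, and remains positive there. -/
theorem det_pos_and_tendsto {k : Fin M.N} {t : ℝ} (ht : t ∈ Icc M.t₀ M.T) {y₀ : Space p}
    (hy₀ : y₀ ∈ closure (M.block k)) {J : Space p → Space p →L[ℝ] Space p}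
    (hc : ContinuousWithinAt J (closure (M.block k)) y₀)
    (hev : ∀ᶠ y in 𝓝[closure (M.block k)] y₀,
      HasFDerivWithinAt (M.X t) (J y) (closure (M.block k)) y) :
    0 < (J y₀).det ∧
      Tendsto (fun y => (fderiv ℝ (M.X t) y).det) (𝓝[M.block k] y₀)
        (𝓝 (J y₀).det) := by
  obtain ⟨c, hc0, hdet⟩ := M.det_pos
  have hlim : Tendsto (fun y => (fderiv ℝ (M.X t) y).det) (𝓝[M.block k] y₀)
      (𝓝 (J y₀).det) := by
    refine ((ContinuousLinearMap.continuous_det.tendsto _).comp (hc.mono subset_closure)).congr' ?_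
    filter_upwards [hev.filter_mono (nhdsWithin_mono _ subset_closure), self_mem_nhdsWithin]
      with y hy hyb
    rw [(hy.hasFDerivAt (mem_of_superset ((M.isOpen_block k).mem_nhds hyb)
      subset_closure)).fderiv]
    rfl
  have : (𝓝[M.block k] y₀).NeBot := mem_closure_iff_nhdsWithin_neBot.1 hy₀
  refine ⟨hc0.trans_le (ge_of_tendsto hlim ?_), hlim⟩
  filter_upwards [self_mem_nhdsWithin] with y hy using hdet t ht k y hy

theorem exists_jacobian {k : Fin M.N} {t : ℝ} (ht : t ∈ Icc M.t₀ M.T) {y₀ : Space p}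
    (hy₀ : y₀ ∈ closure (M.block k)) :
    ∃ A : Space p →L[ℝ] Space p, 0 < A.det ∧
      HasFDerivWithinAt (M.X t) A (closure (M.block k)) y₀ ∧
      Tendsto (fun y => (fderiv ℝ (M.X t) y).det) (𝓝[M.block k] y₀) (𝓝 A.det) := by
  obtain ⟨J, W, hc, -, hev⟩ := M.exists_hasFDerivWithinAt ht hy₀
  obtain ⟨h1, h2⟩ := M.det_pos_and_tendsto ht hy₀ hc (hev.mono fun y hy => hy.1)
  exact ⟨_, h1, (hev.self_of_nhdsWithin hy₀).1, h2⟩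

theorem exists_hasFDerivWithinAt_refVelocity {k : Fin M.N} {t : ℝ} (ht : t ∈ Icc M.t₀ M.T)
    {y₀ : Space p} (hy₀ : y₀ ∈ closure (M.block k)) :
    ∃ A : Space p →L[ℝ] Space p, HasFDerivWithinAt (M.refVelocity t) A (closure (M.block k)) y₀ := by
  obtain ⟨J, W, -, -, hev⟩ := M.exists_hasFDerivWithinAt ht hy₀
  exact ⟨_, (hev.self_of_nhdsWithin hy₀).2⟩

/-- On the closure of a block the velocity is locally controlled by the position, with a constant
that is locally uniform. -/
theorem exists_norm_refVelocity_sub_le_local {k : Fin M.N} {t : ℝ} (ht : t ∈ Icc M.t₀ M.T)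
    {y₀ : Space p} (hy₀ : y₀ ∈ closure (M.block k)) :
    ∃ C : ℝ, ∀ᶠ y in 𝓝[closure (M.block k)] y₀, ∀ᶠ y' in 𝓝[closure (M.block k)] y,
      ‖M.refVelocity t y' - M.refVelocity t y‖ ≤ C * ‖M.X t y' - M.X t y‖ := by
  obtain ⟨J, W, hJ, hW, hev⟩ := M.exists_hasFDerivWithinAt ht hy₀
  obtain ⟨hdet, -⟩ := M.det_pos_and_tendsto ht hy₀ hJ (hev.mono fun y hy => hy.1)
  obtain ⟨κ, hκ, hnear⟩ := exists_eventually_le_norm_apply hJ hdet.ne'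
  refine ⟨(‖W y₀‖ + 2) * (2 / κ), ?_⟩
  filter_upwards [hnear, eventually_norm_lt_of_continuousWithinAt hW, hev] with y hyJ hyW hyev
  filter_upwards [hyev.1.isLittleO.def (half_pos hκ), hyev.2.isLittleO.def one_pos] with y' hX hV
  have e1 : κ / 2 * ‖y' - y‖ ≤ ‖M.X t y' - M.X t y‖ := by
    have h1 := hyJ (y' - y)
    have h2 := norm_sub_norm_le (J y (y' - y)) (M.X t y' - M.X t y)
    rw [norm_sub_rev (J y (y' - y))] at h2
    linarith
  have e2 : ‖M.refVelocity t y' - M.refVelocity t y‖ ≤ (‖W y₀‖ + 2) * ‖y' - y‖ := by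
    have h1 := (W y).le_opNorm (y' - y)
    have h2 := norm_sub_norm_le (M.refVelocity t y' - M.refVelocity t y) (W y (y' - y))
    have h3 : ‖W y‖ * ‖y' - y‖ ≤ (‖W y₀‖ + 1) * ‖y' - y‖ := by gcongr
    linarith
  calc _ ≤ (‖W y₀‖ + 2) * ‖y' - y‖ := e2
    _ = (‖W y₀‖ + 2) * (2 / κ) * (κ / 2 * ‖y' - y‖) := by field_simp
    _ ≤ _ := by gcongr

/-- By compactness of the closed block, one constant serves for all its points. -/
theorem exists_norm_refVelocity_sub_le {t : ℝ} (ht : t ∈ Icc M.t₀ M.T) (k : Fin M.N) :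
    ∃ C : ℝ, ∀ y ∈ closure (M.block k), ∀ᶠ y' in 𝓝[closure (M.block k)] y,
      ‖M.refVelocity t y' - M.refVelocity t y‖ ≤ C * ‖M.X t y' - M.X t y‖ := by
  have hcpt : IsCompact (closure (M.block k)) :=
    (M.isBounded_Ωhat.subset (M.block_subset k)).isCompact_closure
  have hmax : ∀ {C C' : ℝ} {y : Space p}, C ≤ C' → (∀ᶠ y' in 𝓝[closure (M.block k)] y,
      ‖M.refVelocity t y' - M.refVelocity t y‖ ≤ C * ‖M.X t y' - M.X t y‖) →
      ∀ᶠ y' in 𝓝[closure (M.block k)] y,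
      ‖M.refVelocity t y' - M.refVelocity t y‖ ≤ C' * ‖M.X t y' - M.X t y‖ := fun h h' => by
    filter_upwards [h'] with y' hy'
    exact hy'.trans (mul_le_mul_of_nonneg_right h (norm_nonneg _))
  refine hcpt.induction_on (p := fun s => ∃ C : ℝ, ∀ y ∈ s, ∀ᶠ y' in 𝓝[closure (M.block k)] y,
      ‖M.refVelocity t y' - M.refVelocity t y‖ ≤ C * ‖M.X t y' - M.X t y‖) ?_ ?_ ?_ ?_
  · exact ⟨0, fun y hy => absurd hy (notMem_empty y)⟩
  · rintro s s' hss ⟨C, hC⟩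
    exact ⟨C, fun y hy => hC y (hss hy)⟩
  · rintro s s' ⟨C, hC⟩ ⟨C', hC'⟩
    exact ⟨max C C', fun y hy => hy.elim (fun h => hmax (le_max_left _ _) (hC y h))
      fun h => hmax (le_max_right _ _) (hC' y h)⟩
  · intro y₀ hy₀
    obtain ⟨C, hC⟩ := M.exists_norm_refVelocity_sub_le_local ht hy₀
    exact ⟨_, hC, C, fun y hy => hy⟩

/-- Near a point of the closure of the reference domain it suffices to look at the closed blocks
that contain the point. -/
theorem nhdsWithin_closure_Ωhat (y : Space p) :
    𝓝[closure M.Ωhat] y = ⨆ k, 𝓝[closure (M.block k)] y := by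
  rw [← nhdsWithin_iUnion]
  congr 1
  apply Subset.antisymm
  · exact closure_minimal M.subset_closure_block (isClosed_iUnion_of_finite fun k => isClosed_closure)
  · exact iUnion_subset fun k => closure_mono (M.block_subset k)

theorem exists_mem_closure_block {y : Space p} (hy : y ∈ closure M.Ωhat) :
    ∃ k, y ∈ closure (M.block k) := by
  have := closure_minimal M.subset_closure_block
    (isClosed_iUnion_of_finite fun k => isClosed_closure) hy
  exact mem_iUnion.1 this

theorem eventually_nhdsWithin_closure_Ωhat {y : Space p} {P : Space p → Prop}
    (h : ∀ k, y ∈ closure (M.block k) → ∀ᶠ y' in 𝓝[closure (M.block k)] y, P y') :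
    ∀ᶠ y' in 𝓝[closure M.Ωhat] y, P y' := by
  rw [M.nhdsWithin_closure_Ωhat, eventually_iSup]
  intro k
  by_cases hk : y ∈ closure (M.block k)
  · exact h k hk
  · rw [notMem_closure_iff_nhdsWithin_eq_bot.1 (by rwa [closure_closure])]
    exact eventually_bot

theorem continuousOn_refVelocity {t : ℝ} (ht : t ∈ Icc M.t₀ M.T) :
    ContinuousOn (M.refVelocity t) (closure M.Ωhat) := by
  intro y _ s hs
  exact M.eventually_nhdsWithin_closure_Ωhat fun k hk =>
    (M.exists_hasFDerivWithinAt_refVelocity ht hk).choose_spec.continuousWithinAt hs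

theorem exists_norm_refVelocity_sub_le_closure {t : ℝ} (ht : t ∈ Icc M.t₀ M.T) :
    ∃ C : ℝ, ∀ y ∈ closure M.Ωhat, ∀ᶠ y' in 𝓝[closure M.Ωhat] y,
      ‖M.refVelocity t y' - M.refVelocity t y‖ ≤ C * ‖M.X t y' - M.X t y‖ := by
  choose C hC using M.exists_norm_refVelocity_sub_le ht
  obtain ⟨C', hC'⟩ := (finite_range C).bddAbove
  refine ⟨C', fun y _ => M.eventually_nhdsWithin_closure_Ωhat fun k hk => ?_⟩
  filter_upwards [hC k y hk] with y' hy'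
  exact hy'.trans (mul_le_mul_of_nonneg_right (hC' (mem_range_self k)) (norm_nonneg _))

end MovingDomain

/-! ### Velocity and volume in the physical coordinates -/

namespace MovingDomain

variable {p : ℕ} (M : MovingDomain p) {t : ℝ}

theorem invX_X (ht : t ∈ Icc M.t₀ M.T) {y : Space p} (hy : y ∈ closure M.Ωhat) :
    M.invX t (M.X t y) = y :=
  (M.injOn_X t ht).leftInvOn_invFunOn hy

theorem X_invX (ht : t ∈ Icc M.t₀ M.T) {x : Space p} (hx : x ∈ closure (M.Ω t)) :
    M.X t (M.invX t x) = x :=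
  Function.invFunOn_eq ((M.image_closure ht).symm.subset hx)

theorem invX_mem (ht : t ∈ Icc M.t₀ M.T) {x : Space p} (hx : x ∈ closure (M.Ω t)) :
    M.invX t x ∈ closure M.Ωhat :=
  Function.invFunOn_mem ((M.image_closure ht).symm.subset hx)

theorem isOpen_Ω (ht : t ∈ Icc M.t₀ M.T) : IsOpen (M.Ω t) := (M.piecewiseC1 t ht).isOpen

theorem isBounded_Ω (ht : t ∈ Icc M.t₀ M.T) : Bornology.IsBounded (M.Ω t) :=
  (M.piecewiseC1 t ht).isBounded

/-- A continuous injection of the compact set `closure Ω̂` is a homeomorphism onto its image. -/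
theorem continuousOn_invX (ht : t ∈ Icc M.t₀ M.T) :
    ContinuousOn (M.invX t) (closure (M.Ω t)) := by
  have : CompactSpace (closure M.Ωhat) :=
    isCompact_iff_compactSpace.1 M.isBounded_Ωhat.isCompact_closure
  have he : IsClosedEmbedding fun y : closure M.Ωhat => M.X t y :=
    (continuousOn_iff_continuous_domRestrict.1 (M.continuousOn_X_slice ht)).isClosedEmbedding
      fun y y' h => Subtype.ext (M.injOn_X t ht y.2 y'.2 h)
  rw [continuousOn_iff_continuous_domRestrict]
  have hg : Continuous fun x : closure (M.Ω t) =>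
      (⟨M.invX t x, M.invX_mem ht x.2⟩ : closure M.Ωhat) := by
    rw [he.isInducing.continuous_iff]
    exact continuous_subtype_val.congr fun x => (M.X_invX ht x.2).symm
  exact continuous_subtype_val.comp hg

theorem tendsto_invX (ht : t ∈ Icc M.t₀ M.T) {x : Space p} (hx : x ∈ M.Ω t) :
    Tendsto (M.invX t) (𝓝 x) (𝓝[closure M.Ωhat] (M.invX t x)) := by
  have h1 := (M.continuousOn_invX ht x (subset_closure hx)).tendsto_nhdsWithin
    fun x hx => M.invX_mem ht hx
  rwa [nhdsWithin_eq_nhds.2 (mem_of_superset ((M.isOpen_Ω ht).mem_nhds hx) subset_closure)] at h1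

theorem continuousOn_velocity (ht : t ∈ Icc M.t₀ M.T) :
    ContinuousOn (M.velocity t) (closure (M.Ω t)) :=
  (M.continuousOn_refVelocity ht).comp (M.continuousOn_invX ht) fun _ hx => M.invX_mem ht hx

/-- Bounding the velocity increment by the increment of position in the reference coordinates makes
the bound independent of any differentiability of the inverse motion across interfaces. -/
theorem exists_norm_velocity_sub_le (ht : t ∈ Icc M.t₀ M.T) :
    ∃ C : ℝ, ∀ x ∈ M.Ω t, ∀ᶠ x' in 𝓝 x,
      ‖M.velocity t x' - M.velocity t x‖ ≤ C * ‖x' - x‖ := by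
  obtain ⟨C, hC⟩ := M.exists_norm_refVelocity_sub_le_closure ht
  refine ⟨C, fun x hx => ?_⟩
  filter_upwards [(M.tendsto_invX ht hx).eventually (hC _ (M.invX_mem ht (subset_closure hx))),
    (M.isOpen_Ω ht).mem_nhds hx] with x' hx' hxΩ
  rwa [M.X_invX ht (subset_closure hx), M.X_invX ht (subset_closure hxΩ)] at hx'

theorem block_subset_closure (k : Fin M.N) : M.block k ⊆ closure M.Ωhat :=
  (M.block_subset k).trans subset_closure

theorem exists_hasFDerivAt {k : Fin M.N} (ht : t ∈ Icc M.t₀ M.T) {y : Space p}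
    (hy : y ∈ M.block k) : ∃ A : Space p →L[ℝ] Space p, 0 < A.det ∧ HasFDerivAt (M.X t) A y := by
  obtain ⟨A, h1, h2, -⟩ := M.exists_jacobian ht (subset_closure hy)
  exact ⟨A, h1, h2.hasFDerivAt
    (mem_of_superset ((M.isOpen_block k).mem_nhds hy) subset_closure)⟩

theorem differentiableAt_velocity {k : Fin M.N} (ht : t ∈ Icc M.t₀ M.T) {y : Space p}
    (hy : y ∈ M.block k) : DifferentiableAt ℝ (M.velocity t) (M.X t y) := by
  have hyc := M.block_subset_closure k hy
  have hxΩ : M.X t y ∈ M.Ω t := mem_image_of_mem _ (M.block_subset k hy)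
  obtain ⟨A, hdet, hA⟩ := M.exists_hasFDerivAt ht hy
  obtain ⟨W, hW⟩ := M.exists_hasFDerivWithinAt_refVelocity ht (subset_closure hy)
  have hW' : HasFDerivAt (M.refVelocity t) W y := hW.hasFDerivAt
    (mem_of_superset ((M.isOpen_block k).mem_nhds hy) subset_closure)
  have hinv : HasFDerivAt (M.invX t)
      ((A.toContinuousLinearEquivOfDetNeZero hdet.ne').symm : Space p →L[ℝ] Space p)
      (M.X t y) := by
    refine HasFDerivAt.of_local_left_inverse (f := M.X t) ?_ ?_ ?_
    · exact (M.tendsto_invX ht hxΩ).mono_right nhdsWithin_le_nhds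
    · rw [M.invX_X ht hyc]
      exact hA
    · filter_upwards [(M.isOpen_Ω ht).mem_nhds hxΩ] with x hx
        using M.X_invX ht (subset_closure hx)
  rw [← M.invX_X ht hyc] at hW'
  exact (hW'.comp _ hinv).differentiableAt

theorem Ωhat_sdiff_subset : M.Ωhat \ ⋃ k, M.block k ⊆ ⋃ k, frontier (M.block k) := by
  rintro y ⟨hy, hyb⟩
  obtain ⟨k, hk⟩ := M.exists_mem_closure_block (subset_closure hy)
  refine mem_iUnion.2 ⟨k, ?_⟩
  rw [(M.isOpen_block k).frontier_eq]
  exact ⟨hk, fun h => hyb (mem_iUnion.2 ⟨k, h⟩)⟩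

theorem volume_Ωhat_sdiff : volume (M.Ωhat \ ⋃ k, M.block k) = 0 :=
  measure_mono_null M.Ωhat_sdiff_subset (measure_iUnion_null M.volume_frontier_block)

/-- The images of the blocks cover the physical domain up to a null set, since the motion is
differentiable up to the boundary of each block. -/
theorem volume_Ω_sdiff (ht : t ∈ Icc M.t₀ M.T) :
    volume (M.Ω t \ M.X t '' ⋃ k, M.block k) = 0 := by
  refine measure_mono_null (t := ⋃ k, M.X t '' frontier (M.block k)) ?_
    (measure_iUnion_null fun k => ?_)
  · rintro x ⟨⟨y, hy, rfl⟩, hyb⟩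
    rw [← image_iUnion]
    exact mem_image_of_mem _ (M.Ωhat_sdiff_subset ⟨hy, fun h => hyb (mem_image_of_mem _ h)⟩)
  · refine addHaar_image_eq_zero_of_differentiableOn_of_addHaar_eq_zero volume ?_
      (M.volume_frontier_block k)
    intro y hy
    obtain ⟨A, -, hA, -⟩ := M.exists_jacobian ht (frontier_subset_closure hy)
    exact (hA.mono frontier_subset_closure).differentiableWithinAt

theorem ae_differentiableAt_velocity (ht : t ∈ Icc M.t₀ M.T) :
    ∀ᵐ x ∂(volume : Measure (Space p)), x ∈ M.Ω t → DifferentiableAt ℝ (M.velocity t) x := by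
  filter_upwards [measure_eq_zero_iff_ae_notMem.1 (M.volume_Ω_sdiff ht)] with x hx hxΩ
  obtain ⟨y, hy, rfl⟩ : x ∈ M.X t '' ⋃ k, M.block k := by
    by_contra hcon
    exact hx ⟨hxΩ, hcon⟩
  obtain ⟨k, hk⟩ := mem_iUnion.1 hy
  exact M.differentiableAt_velocity ht hk

theorem jac_pos (ht : t ∈ Icc M.t₀ M.T) {y : Space p} (hy : y ∈ closure M.Ωhat) :
    0 < M.jac t y := by
  have hex := M.exists_mem_closure_block hy
  rw [jac, dif_pos hex]
  obtain ⟨A, hA, -, hlim⟩ := M.exists_jacobian ht hex.choose_spec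
  rwa [extendFrom_eq hex.choose_spec hlim]

theorem jac_eq_det {k : Fin M.N} (ht : t ∈ Icc M.t₀ M.T) {y : Space p} (hy : y ∈ M.block k) :
    M.jac t y = (fderiv ℝ (M.X t) y).det := by
  have hex : ∃ k, y ∈ closure (M.block k) := ⟨k, subset_closure hy⟩
  rw [jac, dif_pos hex]
  -- an interior point of a block lies in the closure of no other block
  have hk : hex.choose = k := by
    by_contra hne
    exact disjoint_left.1 ((M.disjoint_block hne).closure_left (M.isOpen_block k))
      hex.choose_spec hy
  obtain ⟨A, -, hA, hlim⟩ := M.exists_jacobian ht hex.choose_spec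
  rw [extendFrom_eq hex.choose_spec hlim]
  rw [hk] at hA
  rw [(hA.hasFDerivAt (mem_of_superset ((M.isOpen_block k).mem_nhds hy) subset_closure)).fderiv]

/-- Change of variables from the reference domain to the physical domain. -/
theorem integral_jac_mul (ht : t ∈ Icc M.t₀ M.T) (G : Space p → ℝ) :
    ∫ y in M.Ωhat, M.jac t y * G (M.X t y) = ∫ x in M.Ω t, G x := by
  have hU : MeasurableSet (⋃ k, M.block k) :=
    (isOpen_iUnion fun k => M.isOpen_block k).measurableSet
  have hsub : ⋃ k, M.block k ⊆ M.Ωhat := iUnion_subset M.block_subset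
  have h1 : (M.Ωhat : Set (Space p)) =ᵐ[volume] ⋃ k, M.block k :=
    (LE.le.eventuallyLE (α := Space p) hsub).antisymm
      (ae_le_set.2 M.volume_Ωhat_sdiff) |>.symm
  have h2 : (M.Ω t : Set (Space p)) =ᵐ[volume] M.X t '' ⋃ k, M.block k :=
    (LE.le.eventuallyLE (α := Space p) (image_mono hsub)).antisymm
      (ae_le_set.2 (M.volume_Ω_sdiff ht)) |>.symm
  rw [setIntegral_congr_set h1, setIntegral_congr_set h2]
  rw [integral_image_eq_integral_abs_det_fderiv_smul volume hU
    (f' := fderiv ℝ (M.X t)) ?_ ((M.injOn_X t ht).mono (hsub.trans subset_closure))]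
  · refine setIntegral_congr_fun hU fun y hy => ?_
    obtain ⟨k, hk⟩ := mem_iUnion.1 hy
    have hpos := M.jac_pos ht (M.block_subset_closure k hk)
    simp only [smul_eq_mul]
    rw [← M.jac_eq_det ht hk, abs_of_pos hpos]
  · intro y hy
    obtain ⟨k, hk⟩ := mem_iUnion.1 hy
    obtain ⟨A, -, hA⟩ := M.exists_hasFDerivAt ht hk
    rw [hA.fderiv]
    exact hA.hasFDerivWithinAt

theorem toFun₂_of_mem {S : Set (ℝ × Space p)} (f : S → ℝ) {x : Space p} (h : (t, x) ∈ S) :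
    toFun₂ f t x = f ⟨(t, x), h⟩ := dif_pos h

theorem mem_physCyl (ht : t ∈ Icc M.t₀ M.T) {x : Space p} (hx : x ∈ closure (M.Ω t)) :
    (t, x) ∈ M.physCyl := ⟨ht, hx⟩

/-- The substitution `φ ↦ φ̂` is an isometry for the volume inner products. -/
theorem volInner_hat (ht : t ∈ Icc M.t₀ M.T) (f g : M.physCyl → ℝ) :
    volInner M.Ωhat (toFun₂ (M.hat f) t) (toFun₂ (M.hat g) t) =
      volInner (M.Ω t) (toFun₂ f t) (toFun₂ g t) := by
  rw [volInner, volInner, ← M.integral_jac_mul ht]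
  refine setIntegral_congr_fun M.isOpen_Ωhat.measurableSet fun y hy => ?_
  have hyc : y ∈ closure M.Ωhat := subset_closure hy
  have hx : M.X t y ∈ closure (M.Ω t) := subset_closure (mem_image_of_mem _ hy)
  have hq : (t, y) ∈ M.refCyl := ⟨ht, hyc⟩
  have hpos := M.jac_pos ht hyc
  simp only [toFun₂_of_mem _ hq, toFun₂_of_mem _ (M.mem_physCyl ht hx), hat, toPhys]
  rw [mul_mul_mul_comm, Real.mul_self_sqrt hpos.le]

theorem toPhys_toRef (q : M.physCyl) : M.toPhys (M.toRef q) = q := by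
  apply Subtype.ext
  exact Prod.ext rfl (M.X_invX q.2.1 q.2.2)

theorem unhat_hat (φ : M.physCyl → ℝ) : M.unhat (M.hat φ) = φ := by
  ext q
  have hpos := M.jac_pos (M.toRef q).2.1 (M.toRef q).2.2
  simp only [unhat, hat]
  rw [inv_mul_cancel_left₀ (Real.sqrt_pos.2 hpos).ne', M.toPhys_toRef]

theorem toPhysLat_surjective : Function.Surjective M.toPhysLat := by
  intro q
  have ht : q.1.1 ∈ Icc M.t₀ M.T := Ioo_subset_Icc_self q.2.1
  have hqc : q.1.2 ∈ closure (M.Ω q.1.1) := frontier_subset_closure q.2.2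
  have hmem : M.invX q.1.1 q.1.2 ∈ frontier M.Ωhat := by
    rw [M.isOpen_Ωhat.frontier_eq]
    refine ⟨M.invX_mem ht hqc, fun h => ?_⟩
    have := q.2.2
    rw [(M.isOpen_Ω ht).frontier_eq] at this
    exact this.2 ⟨_, h, M.X_invX ht hqc⟩
  refine ⟨⟨(q.1.1, M.invX q.1.1 q.1.2), q.2.1, hmem⟩, Subtype.ext (Prod.ext rfl ?_)⟩
  exact M.X_invX ht hqc

/-- The boundary conditions `B̂ φ̂ = 0` and `B φ = 0` agree, since the motion maps the boundary of
the reference domain onto the boundary of the physical domain. -/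
theorem zero_mem_Bhat_hat (B : M.BoundaryOperator) (φ : M.physCyl → ℝ) :
    0 ∈ M.Bhat B (M.hat φ) ↔ 0 ∈ B φ := by
  rw [Bhat, unhat_hat, Part.mem_map_iff]
  constructor
  · rintro ⟨g, hg, hg0⟩
    have : g = 0 := by
      ext q
      obtain ⟨q', rfl⟩ := M.toPhysLat_surjective q
      exact congrFun hg0 q'
    rwa [this] at hg
  · intro h
    exact ⟨0, h, rfl⟩

theorem mem_Dhat_hat (D : M.Operator) (φ : M.physCyl → ℝ) (ψ : M.refCyl → ℝ) :
    ψ ∈ M.Dhat D (M.hat φ) ↔ ∃ g ∈ D φ, M.hat (g + M.Dm φ) = ψ := by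
  rw [Dhat, unhat_hat, Part.mem_map_iff]

end MovingDomain

/-! ### The energy identity -/

section Product

variable {p : ℕ} {Ω : Set (Space p)} {a : Space p → ℝ} {V : Space p → Space p}

theorem divergence_smul {x : Space p} (ha : DifferentiableAt ℝ a x) (hV : DifferentiableAt ℝ V x) :
    divergence (fun y => a y • V y) x = a x * divergence V x + inner ℝ (gradient a x) (V x) := by
  have h : ∀ i : Fin p, (fderiv ℝ (fun y => a y • V y) x (EuclideanSpace.single i 1)) i =
      a x * (fderiv ℝ V x (EuclideanSpace.single i 1)) i +
        fderiv ℝ a x (EuclideanSpace.single i 1) * V x i := fun i => by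
    rw [fderiv_fun_smul ha hV]
    simp
  simp only [divergence, h, Finset.sum_add_distrib, ← Finset.mul_sum]
  congr 1
  rw [inner_gradient_left]
  conv_rhs => rw [← (EuclideanSpace.basisFun (Fin p) ℝ).sum_repr (V x)]
  rw [map_sum]
  refine Finset.sum_congr rfl fun i _ => ?_
  simp [mul_comm]

theorem exists_norm_smul_sub_le (hΩ : IsOpen Ω) (hb : Bornology.IsBounded Ω)
    (ha : ContinuousOn a (closure Ω)) (hV : ContinuousOn V (closure Ω))
    (hal : ∃ C, ∀ x ∈ Ω, ∀ᶠ y in 𝓝 x, |a y - a x| ≤ C * ‖y - x‖)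
    (hVl : ∃ C, ∀ x ∈ Ω, ∀ᶠ y in 𝓝 x, ‖V y - V x‖ ≤ C * ‖y - x‖) :
    ∃ C, ∀ x ∈ Ω, ∀ᶠ y in 𝓝 x, ‖a y • V y - a x • V x‖ ≤ C * ‖y - x‖ := by
  obtain ⟨A, hA⟩ := hb.isCompact_closure.exists_bound_of_continuousOn ha
  obtain ⟨B, hB⟩ := hb.isCompact_closure.exists_bound_of_continuousOn hV
  obtain ⟨C, hC⟩ := hal
  obtain ⟨C', hC'⟩ := hVl
  refine ⟨A * C' + C * B, fun x hx => ?_⟩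
  filter_upwards [hC x hx, hC' x hx, hΩ.mem_nhds hx] with y h1 h2 hy
  have h3 : a y • V y - a x • V x = a y • (V y - V x) + (a y - a x) • V x := by
    rw [smul_sub, sub_smul]; abel
  rw [h3]
  refine (norm_add_le _ _).trans ?_
  rw [norm_smul, norm_smul, add_mul]
  have hAy := hA y (subset_closure hy)
  have hBx := hB x (subset_closure hx)
  have e1 : ‖a y‖ * ‖V y - V x‖ ≤ A * (C' * ‖y - x‖) :=
    mul_le_mul hAy h2 (norm_nonneg _) ((norm_nonneg _).trans hAy)
  have e2 : ‖a y - a x‖ * ‖V x‖ ≤ (C * ‖y - x‖) * B :=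
    mul_le_mul h1 hBx (norm_nonneg _) ((abs_nonneg _).trans h1)
  linarith

end Product

namespace MovingDomain

variable {p : ℕ} (M : MovingDomain p) {t : ℝ}

theorem continuousOn_toFun₂ (ht : t ∈ Icc M.t₀ M.T) {φ : M.physCyl → ℝ} (hφ : Continuous φ) :
    ContinuousOn (toFun₂ φ t) (closure (M.Ω t)) := by
  rw [continuousOn_iff_continuous_domRestrict]
  have h1 : Continuous fun x : closure (M.Ω t) =>
      (⟨(t, x), M.mem_physCyl ht x.2⟩ : M.physCyl) := by fun_prop
  exact (hφ.comp h1).congr fun x => (toFun₂_of_mem φ (M.mem_physCyl ht x.2)).symm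

theorem differentiableAt_of_mem_admissible {D : M.Operator} {φ : M.physCyl → ℝ}
    (hφ : φ ∈ M.admissible D) (ht : t ∈ Icc M.t₀ M.T) {x : Space p} (hx : x ∈ M.Ω t) :
    DifferentiableAt ℝ (toFun₂ φ t) x := by
  obtain ⟨-, -, ⟨G, -, hG⟩, -⟩ := hφ
  exact (hG ⟨(t, x), M.mem_physCyl ht (subset_closure hx)⟩ hx).differentiableAt

/-- The gradient extends continuously to the compact closure of `Ω(t)`, so that it is bounded. -/
theorem exists_abs_toFun₂_sub_le {D : M.Operator} {φ : M.physCyl → ℝ}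
    (hφ : φ ∈ M.admissible D) (ht : t ∈ Icc M.t₀ M.T) :
    ∃ C, ∀ x ∈ M.Ω t, ∀ᶠ y in 𝓝 x, |toFun₂ φ t y - toFun₂ φ t x| ≤ C * ‖y - x‖ := by
  obtain ⟨-, -, ⟨G, hGc, hG⟩, -⟩ := hφ
  have hslice : Continuous fun x : closure (M.Ω t) =>
      (⟨(t, x), M.mem_physCyl ht x.2⟩ : M.physCyl) := by fun_prop
  have : CompactSpace (closure (M.Ω t)) :=
    isCompact_iff_compactSpace.1 (M.isBounded_Ω ht).isCompact_closure
  obtain ⟨C, hC⟩ := (isCompact_univ (X := closure (M.Ω t))).exists_bound_of_continuousOn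
    (hGc.comp hslice).continuousOn
  refine ⟨C + 1, fun x hx => ?_⟩
  have hgrad := (hG ⟨(t, x), M.mem_physCyl ht (subset_closure hx)⟩ hx).hasFDerivAt
  filter_upwards [hgrad.isLittleO.def one_pos] with y hy
  have h1 := hC ⟨x, subset_closure hx⟩ (mem_univ _)
  rw [InnerProductSpace.toDual_apply_apply] at hy
  have h2 := norm_inner_le_norm (𝕜 := ℝ) (G ⟨(t, x), M.mem_physCyl ht (subset_closure hx)⟩) (y - x)
  have h3 := norm_sub_norm_le (toFun₂ φ t y - toFun₂ φ t x)
    (inner ℝ (G ⟨(t, x), M.mem_physCyl ht (subset_closure hx)⟩) (y - x))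
  have h4 : ‖G ⟨(t, x), M.mem_physCyl ht (subset_closure hx)⟩‖ * ‖y - x‖ ≤ C * ‖y - x‖ :=
    mul_le_mul_of_nonneg_right h1 (norm_nonneg _)
  rw [← Real.norm_eq_abs]
  linarith

/-- The energy identity: `φ D_m φ` is half the divergence of `φ² ẋ`, so that its integral is the
boundary term. -/
theorem volInner_add_Dm (hp : 1 ≤ p) {D : M.Operator} {φ : M.physCyl → ℝ}
    (hφ : φ ∈ M.admissible D) {g : M.physCyl → ℝ} (hg : g ∈ D φ) (ht : t ∈ Icc M.t₀ M.T) :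
    volInner (M.Ω t) (toFun₂ φ t) (toFun₂ (g + M.Dm φ) t) =
      volInner (M.Ω t) (toFun₂ φ t) (toFun₂ g t) +
        (1 / 2) * surfInner (M.Ω t) (toFun₂ φ t)
          (fun x => inner ℝ (outwardNormal (M.Ω t) x) (M.velocity t x) * toFun₂ φ t x) := by
  have hΩ := M.piecewiseC1 t ht
  change IsPiecewiseC1Domain (M.Ω t) at hΩ
  have hgc : Continuous g := by
    obtain ⟨-, -, -, g', hg', hg'c⟩ := hφ
    rwa [Part.mem_unique hg hg']
  have hφc := M.continuousOn_toFun₂ ht hφ.1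
  have hvc := M.continuousOn_velocity ht
  have hφl := M.exists_abs_toFun₂_sub_le hφ ht
  set u : Space p → ℝ := toFun₂ φ t with hu
  -- the product rule is applied to `φ² ẋ = u w`, with `w = u ẋ` as it occurs in `D_m`
  set w : Space p → Space p := fun x => u x • M.velocity t x with hw
  have hwl : ∃ C, ∀ x ∈ M.Ω t, ∀ᶠ y in 𝓝 x, ‖w y - w x‖ ≤ C * ‖y - x‖ :=
    exists_norm_smul_sub_le hΩ.isOpen hΩ.isBounded hφc hvc hφl
      (M.exists_norm_velocity_sub_le ht)
  have hwc : ContinuousOn w (closure (M.Ω t)) := hφc.smul hvc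
  have hVc : ContinuousOn (fun x => u x • w x) (closure (M.Ω t)) := hφc.smul hwc
  have hVd : ∀ᵐ x ∂(volume : Measure (Space p)), x ∈ M.Ω t →
      DifferentiableAt ℝ (fun x => u x • w x) x := by
    filter_upwards [M.ae_differentiableAt_velocity ht] with x hx hxΩ
    have hux := M.differentiableAt_of_mem_admissible hφ ht hxΩ
    exact hux.smul (hux.smul (hx hxΩ))
  obtain ⟨hint, hdiv⟩ := integral_divergence_eq hp hΩ hVc
    (exists_norm_smul_sub_le hΩ.isOpen hΩ.isBounded hφc hwc hφl hwl) hVd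
  have hpt : ∀ᵐ x ∂(volume : Measure (Space p)), x ∈ M.Ω t →
      u x * toFun₂ (g + M.Dm φ) t x =
        u x * toFun₂ g t x + (1 / 2) * divergence (fun x => u x • w x) x := by
    filter_upwards [M.ae_differentiableAt_velocity ht] with x hx hxΩ
    have hux := M.differentiableAt_of_mem_admissible hφ ht hxΩ
    have hmem := M.mem_physCyl ht (subset_closure hxΩ)
    have hwx : DifferentiableAt ℝ w x := hux.smul (hx hxΩ)
    rw [divergence_smul (a := u) (V := w) hux hwx, toFun₂_of_mem _ hmem, toFun₂_of_mem g hmem]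
    have hin : inner ℝ (gradient u x) (w x) = u x * inner ℝ (M.velocity t x) (gradient u x) := by
      rw [hw, inner_smul_right, real_inner_comm]
    rw [hin]
    simp only [Pi.add_apply, Dm]
    change u x * (_ + 1 / 2 * (inner ℝ (M.velocity t x) (gradient u x) + divergence w x)) = _
    ring
  have hgint : IntegrableOn (fun x => u x * toFun₂ g t x) (M.Ω t) :=
    ((hφc.mul (M.continuousOn_toFun₂ ht hgc)).integrableOn_compact
      hΩ.isBounded.isCompact_closure).mono_set subset_closure
  rw [volInner, setIntegral_congr_ae hΩ.isOpen.measurableSet hpt,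
    integral_add hgint (hint.const_mul _), integral_const_mul, hdiv, volInner, surfInner]
  congr 3
  ext x
  simp only [hw, inner_smul_right]
  ring

end MovingDomain

end MovingMesh

theorem mainTheorem1 {p : ℕ} (hp : 1 ≤ p) (M : MovingMesh.MovingDomain p)
    (D : M.Operator) (B : M.BoundaryOperator) (α : ℝ) :
    (∀ φ ∈ M.admissible D, 0 ∈ B φ → ∀ Dφ ∈ D φ, ∀ t ∈ Set.Ioo M.t₀ M.T,
      MovingMesh.volInner (M.Ω t) (MovingMesh.toFun₂ φ t) (MovingMesh.toFun₂ Dφ t) +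
        (1 / 2) * MovingMesh.surfInner (M.Ω t) (MovingMesh.toFun₂ φ t)
          (fun x => inner ℝ (MovingMesh.outwardNormal (M.Ω t) x) (M.velocity t x) *
            MovingMesh.toFun₂ φ t x) ≤
      α * MovingMesh.volInner (M.Ω t) (MovingMesh.toFun₂ φ t) (MovingMesh.toFun₂ φ t)) ↔
    (∀ ψ ∈ M.admissibleHat D, 0 ∈ M.Bhat B ψ → ∀ Dψ ∈ M.Dhat D ψ, ∀ t ∈ Set.Ioo M.t₀ M.T,
      MovingMesh.volInner M.Ωhat (MovingMesh.toFun₂ ψ t) (MovingMesh.toFun₂ Dψ t) ≤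
      α * MovingMesh.volInner M.Ωhat (MovingMesh.toFun₂ ψ t) (MovingMesh.toFun₂ ψ t)) := by
  open MovingMesh in
  have key : ∀ φ ∈ M.admissible D, ∀ g ∈ D φ, ∀ t ∈ Set.Ioo M.t₀ M.T,
      (volInner M.Ωhat (toFun₂ (M.hat φ) t) (toFun₂ (M.hat (g + M.Dm φ)) t) ≤
        α * volInner M.Ωhat (toFun₂ (M.hat φ) t) (toFun₂ (M.hat φ) t)) ↔
      (volInner (M.Ω t) (toFun₂ φ t) (toFun₂ g t) +
        (1 / 2) * surfInner (M.Ω t) (toFun₂ φ t)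
          (fun x => inner ℝ (outwardNormal (M.Ω t) x) (M.velocity t x) * toFun₂ φ t x) ≤
      α * volInner (M.Ω t) (toFun₂ φ t) (toFun₂ φ t)) := by
    intro φ hφ g hg t ht
    have ht' := Ioo_subset_Icc_self ht
    rw [M.volInner_hat ht', M.volInner_hat ht', M.volInner_add_Dm hp hφ hg ht']
  constructor
  · rintro h _ ⟨φ, hφ, rfl⟩ hB Dψ hD t ht
    obtain ⟨g, hg, rfl⟩ := (M.mem_Dhat_hat D φ Dψ).1 hD
    exact (key φ hφ g hg t ht).2 (h φ hφ ((M.zero_mem_Bhat_hat B φ).1 hB) g hg t ht)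
  · intro h φ hφ hB g hg t ht
    exact (key φ hφ g hg t ht).1 (h _ (mem_image_of_mem _ hφ) ((M.zero_mem_Bhat_hat B φ).2 hB) _
      ((M.mem_Dhat_hat D φ _).2 ⟨g, hg, rfl⟩) t ht)
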